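/- Let $M$ be a compact oriented 3-manifold with boundary, with a fixed (generalized) triangulation, i.e. $M$ is obtained from finitely many tetrahedra by gluing facets in pairs by affine maps. Let $T_1\neq T_2$ be two torus components of $\partial M$ on which the triangulation restricts to a one-vertex triangulation (two triangles). A *normal arc* in a 2-simplex is a properly embedded arc joining interior points of two distinct edges. A *normal loop* on the boundary of a tetrahedron is an embedded loop consisting of normal arcs; a *normal isotopy* is an isotopy preserving every simplex. A compact properly embedded surface $S\subset M$ is *normal with respect to the 2-skeleton* if it meets the boundary of every tetrahedron in a (possibly empty) collection of disjoint normal loops. Two such surfaces $F,G$ are *compatible* if on the boundary of each tetrahedron $\Delta$ the systems $F\cap\partial\Delta$ and $G\cap\partial\Delta$ can be normally isotoped to be disjoint. A *compatibility class* is a maximal set of pairwise compatible surfaces that are normal with respect to the 2-skeleton. On each $T_m$ fix one of the two triangles; for $i=1,2,3$ let $x_i(S)$ be the number of arcs of $S$ in this triangle that cut off its $i$-th corner, and say that $S\cap T_m$ has *type* $i$ if $x_i(S)\le x_j(S)$ for all $j$. A *typed compatibility class* consists of all surfaces $S$ in a given compatibility class such that $S\cap T_1$ has type $i$ and $S\cap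 T_2$ has type $j$, for a given pair $(i,j)$. Fix bases of $H_1(T_1;\mathbb Z)$ and $H_1(T_2;\mathbb Z)$ such that the orientation determined by the basis agrees with the induced boundary orientation on $T_1$ and disagrees with it on $T_2$. The *slope* of an essential simple closed curve on $T_m$ with homology class $(a,b)$ is $a/b\in\widehat{\mathbb Q}=\mathbb Q\cup\{1/0\}$. The *slope* $\langle S\cap T_m\rangle$ of $S$ on $T_m$, defined if $S\cap T_m$ contains an essential curve, is the slope of an essential component of $S\cap T_m$. The group $SL_2(\mathbb Q)$ acts on $\widehat{\mathbb Q}$ by linear fractional transformations. **Lemma.** For every typed compatibility class $\mathcal C$ there is $\Phi_{\mathcal C}\in SL_2(\mathbb Q)$ such that, for every $S\in\mathcal C$ with $S\cap\partial M\subset T_1\cup T_2$ that has a slope on both $T_1$ and $T_2$ (i.e. meets each of them in at least one essential curve), $$\Phi_{\mathcal C}\big(\langle S\cap T_2\rangle\big)=\langle S\cap T_1\rangle .$$ -/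

import Mathlib

open scoped MatrixGroups OnePoint

noncomputable section

namespace NormalSurf

/-- The standard 3-simplex; its points are given by barycentric coordinates. -/
abbrev Tetra : Type := stdSimplex ℝ (Fin 4)

/-- The closed 2-simplex (facet) of the tetrahedron opposite to the vertex `k`. -/
def facet (k : Fin 4) : Set Tetra := {x | x k = 0}

/-- The boundary of the tetrahedron. -/
def bdry : Set Tetra := {x | ∃ k, x k = 0}

/-- The smallest face containing `x` is determined by the set of vanishing coordinates. -/
def zeros (x : Tetra) : Set (Fin 4) := {i | x i = 0}

/-! ### Triangulated oriented 3-manifolds -/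

/-- A (generalized) triangulation with an orientation: finitely many tetrahedra whose facets are
glued in pairs by affine maps. `glue t k = some (t₁, π)` says that the facet of `t` opposite to
the vertex `k` is glued to the facet of `t₁` opposite to `π k`, the vertex `j ≠ k` of `t` going to
the vertex `π j` of `t₁`; `glue t k = none` says that this facet is free.
`orient t` is `1` when the vertex order `0, 1, 2, 3` of `t` is positive; gluings are
compatible with these orientations (a gluing with `π = id` is a reflection). -/
structure OrientedTriangulation where
  /-- the tetrahedra -/
  Tet : Type
  finite_tet : Finite Tet
  /-- the facet gluings -/
  glue : Tet → Fin 4 → Option (Tet × Equiv.Perm (Fin 4))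
  glue_symm : ∀ t k t₁ π, glue t k = some (t₁, π) → glue t₁ (π k) = some (t, π⁻¹)
  glue_ne : ∀ t k t₁ π, glue t k = some (t₁, π) → (t₁, π k) ≠ (t, k)
  /-- the orientation of each tetrahedron -/
  orient : Tet → ℤˣ
  orient_glue : ∀ t k t₁ π, glue t k = some (t₁, π) →
    orient t₁ = -(Equiv.Perm.sign π * orient t)

namespace OrientedTriangulation

variable (K : OrientedTriangulation)

/-- Elementary identifications of points of the disjoint union of the tetrahedra. -/
inductive Rel : (Σ _ : K.Tet, Tetra) → (Σ _ : K.Tet, Tetra) → Prop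
  | mk (t : K.Tet) (k : Fin 4) (t₁ : K.Tet) (π : Equiv.Perm (Fin 4)) (x : Tetra)
      (h : K.glue t k = some (t₁, π)) (hx : x k = 0) :
      Rel ⟨t, x⟩ ⟨t₁, stdSimplex.map π x⟩

/-- The underlying space of the triangulation: the quotient of the disjoint union of the
tetrahedra by the gluings, with the quotient topology. -/
def Space : Type := Quot K.Rel

instance : TopologicalSpace K.Space :=
  inferInstanceAs (TopologicalSpace (Quot K.Rel))

/-- The characteristic map of the tetrahedron `t`. -/
def char (t : K.Tet) (x : Tetra) : K.Space := Quot.mk K.Rel ⟨t, x⟩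

/-- The boundary of the underlying space: the union of the free facets. -/
def boundary : Set K.Space :=
  {p | ∃ t k x, K.glue t k = none ∧ x ∈ facet k ∧ K.char t x = p}

/-- The underlying space is a topological 3-manifold whose boundary is the union of
the free facets. -/
def IsManifold : Prop :=
  (∀ p : K.Space, p ∉ K.boundary →
    ∃ U : Set K.Space, IsOpen U ∧ p ∈ U ∧ Nonempty (U ≃ₜ EuclideanSpace ℝ (Fin 3))) ∧
  (∀ p : K.Space, p ∈ K.boundary →
    ∃ U : Set K.Space, IsOpen U ∧ p ∈ U ∧ ∃ φ : U ≃ₜ EuclideanHalfSpace 3,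
      ∀ y : U, y.1 ∈ K.boundary ↔ (φ y).1 0 = 0)

/-- `S` is a compact properly embedded (locally flat) surface: near interior points `S` looks
like a plane in 3-space, and near points of the boundary of the manifold it looks like a half-plane
orthogonal to the boundary of a half-space. -/
def IsProperSurface (S : Set K.Space) : Prop :=
  IsClosed S ∧
  (∀ p ∈ S, p ∉ K.boundary →
    ∃ U : Set K.Space, IsOpen U ∧ p ∈ U ∧ ∃ φ : U ≃ₜ EuclideanSpace ℝ (Fin 3),
      ∀ y : U, y.1 ∈ S ↔ φ y 2 = 0) ∧
  (∀ p ∈ S, p ∈ K.boundary →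
    ∃ U : Set K.Space, IsOpen U ∧ p ∈ U ∧ ∃ φ : U ≃ₜ EuclideanHalfSpace 3,
      (∀ y : U, y.1 ∈ K.boundary ↔ (φ y).1 0 = 0) ∧ (∀ y : U, y.1 ∈ S ↔ (φ y).1 2 = 0))

/-- `S ∩ ∂Δ` for the tetrahedron `Δ = t`, as a subset of the boundary of the model simplex. -/
def trace (S : Set K.Space) (t : K.Tet) : Set Tetra := {x | x ∈ bdry ∧ K.char t x ∈ S}

end OrientedTriangulation

/-! ### Normal arcs, normal loops, normal isotopy -/

/-- `A` is a normal arc of the facet `k` that cuts off the vertex `v`: an embedded arc, with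
interior in the interior of the facet, which joins interior points of the two distinct
edges of this facet at `v` (the edges opposite, in the facet, to the other vertices `u` and `w`). -/
def IsNormalArc (k v : Fin 4) (A : Set Tetra) : Prop :=
  ∃ u w : Fin 4, [k, v, u, w].Nodup ∧
    ∃ γ : unitInterval → Tetra, Continuous γ ∧ Function.Injective γ ∧ Set.range γ = A ∧
      zeros (γ 0) = {k, u} ∧ zeros (γ 1) = {k, w} ∧ ∀ s, 0 < s → s < 1 → zeros (γ s) = {k}

/-- `L` is a normal loop: an embedded circle in the boundary of the tetrahedron that consists
of normal arcs. -/
def IsNormalLoop (L : Set Tetra) : Prop :=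
  L ⊆ bdry ∧
  (∃ γ : UnitAddCircle → Tetra, Continuous γ ∧ Function.Injective γ ∧ Set.range γ = L) ∧
  ∀ k, ∃ F : Set (Set Tetra), F.Finite ∧ F.PairwiseDisjoint id ∧
    (∀ A ∈ F, ∃ v, IsNormalArc k v A) ∧ L ∩ facet k = ⋃₀ F

/-- `X` is a (finite, possibly empty) collection of pairwise disjoint normal loops. -/
def IsNormalLoopCollection (X : Set Tetra) : Prop :=
  ∃ F : Set (Set Tetra), F.Finite ∧ F.PairwiseDisjoint id ∧ (∀ L ∈ F, IsNormalLoop L) ∧ X = ⋃₀ F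

/-- `X` can be moved to `Y` by a normal isotopy: an isotopy that preserves every open simplex of
the tetrahedron. -/
def NormallyIsotopic (X Y : Set Tetra) : Prop :=
  ∃ H : unitInterval × X → Tetra, Continuous H ∧
    (∀ s, Function.Injective fun x => H (s, x)) ∧
    (∀ x, H (0, x) = x.1) ∧
    (∀ s x, zeros (H (s, x)) = zeros x.1) ∧
    Set.range (fun x => H (1, x)) = Y

namespace OrientedTriangulation

variable (K : OrientedTriangulation)

/-- `S` is a surface that is normal with respect to the 2-skeleton. -/
def IsNormalSurface (S : Set K.Space) : Prop :=
  K.IsProperSurface S ∧ ∀ t, IsNormalLoopCollection (K.trace S t)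

/-- On the boundary of each tetrahedron the two systems of normal loops can be normally isotoped
to be disjoint. -/
def Compatible (F G : Set K.Space) : Prop :=
  ∀ t, ∃ X Y : Set Tetra, NormallyIsotopic (K.trace F t) X ∧ NormallyIsotopic (K.trace G t) Y ∧
    Disjoint X Y

/-- A compatibility class: a maximal set of pairwise compatible surfaces that are normal with
respect to the 2-skeleton. -/
def IsCompatibilityClass (C : Set (Set K.Space)) : Prop :=
  Maximal (fun D : Set (Set K.Space) => (∀ S ∈ D, K.IsNormalSurface S) ∧ D.Pairwise K.Compatible) C

/-! ### Torus boundary components with one-vertex triangulations -/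

/-- A component of the boundary with the one-vertex triangulation of the torus. It has two
triangles: triangle `j` is the free facet opposite to the vertex `lab j 0` of the tetrahedron
`tet j`, and its vertices are `lab j 1`, `lab j 2`, `lab j 3`, in an order that is positive for
the orientation induced on the boundary (outward normal first). The edge of triangle `0` between its
vertices number `a` and `b` is glued to the edge of triangle `1` between its vertices with the
same numbers, vertex `a` going to vertex `b` and vertex `b` to vertex `a`: the two
triangles form a parallelogram with a diagonal, with opposite sides identified by translation. -/
structure BoundaryTorus where
  tet : Fin 2 → K.Tet
  lab : Fin 2 → Equiv.Perm (Fin 4)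
  free : ∀ j, K.glue (tet j) (lab j 0) = none
  distinct : (tet 0, lab 0 0) ≠ (tet 1, lab 1 0)
  positive : ∀ j, Equiv.Perm.sign (lab j) = K.orient (tet j)
  edges : ∀ a b : Fin 4, a ≠ 0 → b ≠ 0 → a ≠ b → ∀ x : Tetra,
    (∀ l, l ≠ a → l ≠ b → x (lab 0 l) = 0) →
    K.char (tet 0) x =
      K.char (tet 1) (stdSimplex.map (fun i => lab 1 (Equiv.swap a b ((lab 0).symm i))) x)
  component : ∃ p ∈ K.boundary,
    ⋃ j, K.char (tet j) '' facet (lab j 0) = connectedComponentIn K.boundary p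

namespace BoundaryTorus

variable {K} (T : K.BoundaryTorus)

/-- The torus as a subset of the manifold. -/
def carrier : Set K.Space := ⋃ j, K.char (T.tet j) '' facet (T.lab j 0)

/-- A homology basis of the torus, given by an identification with `ℝ/ℤ × ℝ/ℤ`: the basis consists
of the classes of the two coordinate circles (every basis arises so). -/
abbrev HomologyBasis : Type := T.carrier ≃ₜ UnitAddCircle × UnitAddCircle

/-- Write the first two sides (from vertex `1` to vertex `2` to vertex `3`) of the triangle `0`
of the torus, which is positively oriented for the induced boundary orientation, as loops of the
one-vertex triangulation. The property says that the determinant of their homology classes in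
the basis `h` is `d`. Here `φ` lifts the triangle to the universal cover `ℝ × ℝ`, so
that the classes of the sides are the differences of the lifted vertices.
In an oriented torus the algebraic intersection number of these two loops is `1`, so the
determinant is `1` if the orientation given by the basis agrees with the induced boundary
orientation, and `-1` if it disagrees. -/
def BasisSign (h : T.HomologyBasis) (d : ℝ) : Prop :=
  ∃ φ : Tetra → ℝ × ℝ, ContinuousOn φ (facet (T.lab 0 0)) ∧
    (∀ x ∈ facet (T.lab 0 0), ∀ y : T.carrier, y.1 = K.char (T.tet 0) x →
      h y = (((φ x).1 : UnitAddCircle), ((φ x).2 : UnitAddCircle))) ∧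
    let P : Fin 4 → ℝ × ℝ := fun i => φ (stdSimplex.vertex (T.lab 0 i))
    ((P 2).1 - (P 1).1) * ((P 3).2 - (P 2).2) - ((P 2).2 - (P 1).2) * ((P 3).1 - (P 2).1) = d

/-- The orientation of the basis agrees with the induced boundary orientation. -/
def BasisAgrees (h : T.HomologyBasis) : Prop := T.BasisSign h 1

/-- The orientation of the basis disagrees with the induced boundary orientation. -/
def BasisDisagrees (h : T.HomologyBasis) : Prop := T.BasisSign h (-1)

/-- The normal coordinates of `S ∩ T`: the number of normal arcs of `S` that cut off the corner
number `i + 1` of the triangle `0` of the torus. -/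
def coord (S : Set K.Space) (i : Fin 3) : ℕ :=
  {A : Set Tetra | IsNormalArc (T.lab 0 0) (T.lab 0 i.succ) A ∧
    A ⊆ K.trace S (T.tet 0)}.ncard

/-- The curve `S ∩ T` has type `i`: its `i`-th normal coordinate is minimal. -/
def HasType (S : Set K.Space) (i : Fin 3) : Prop := ∀ j, T.coord S i ≤ T.coord S j

/-- The closed curve `γ` in the torus has homology class `(a, b)` in the basis `h`: a lift to the
universal cover `ℝ × ℝ` is translated by `(a, b)`. -/
def HasClass (h : T.HomologyBasis) (γ : UnitAddCircle → T.carrier) (a b : ℤ) : Prop :=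
  ∃ g : ℝ → ℝ × ℝ, Continuous g ∧
    (∀ s : ℝ, h (γ (s : UnitAddCircle)) =
      (((g s).1 : UnitAddCircle), ((g s).2 : UnitAddCircle))) ∧
    ∀ s : ℝ, g (s + 1) = g s + ((a : ℝ), (b : ℝ))

end BoundaryTorus

end OrientedTriangulation

/-- The slope `a / b` in `ℚ ∪ {1/0}` of the class `(a, b)`. -/
def slopeOf (a b : ℤ) : OnePoint ℚ := if b = 0 then ∞ else (((a : ℚ) / (b : ℚ) : ℚ) : OnePoint ℚ)

namespace OrientedTriangulation

variable {K : OrientedTriangulation}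

/-- `r` is the slope of `S` on the torus `T`, with respect to the basis `h`: some component of
`S ∩ T` is an essential simple closed curve (its homology class is not zero) of slope `r`. -/
def BoundaryTorus.IsSlope (T : K.BoundaryTorus) (h : T.HomologyBasis) (S : Set K.Space)
    (r : OnePoint ℚ) : Prop :=
  ∃ γ : UnitAddCircle → T.carrier, Continuous γ ∧ Function.Injective γ ∧
    (∃ p ∈ S ∩ T.carrier,
      Subtype.val '' Set.range γ = connectedComponentIn (S ∩ T.carrier) p) ∧
    ∃ a b : ℤ, (a, b) ≠ (0, 0) ∧ T.HasClass h γ a b ∧ r = slopeOf a b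

/-- The surfaces of `C` whose boundary curves on the tori `T₁` and `T₂` have the types `i`
and `j`. -/
def typedClass (T₁ T₂ : K.BoundaryTorus) (C : Set (Set K.Space)) (i j : Fin 3) :
    Set (Set K.Space) :=
  {S ∈ C | T₁.HasType S i ∧ T₂.HasType S j}

end OrientedTriangulation

end NormalSurf

end

/-! Let `F` and `G` be compatible, with normal coordinates `x` and `y` at the corners of a triangle.
On the boundary of one tetrahedron, the alternating forms `x₁y₂ - x₂y₁ + x₂y₃ - x₃y₂ + x₃y₁ - x₁y₃`
of the four facets, taken with boundary orientation, add up to zero (`sum_sign_ncard_mul_ncard`). To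
see this, make the traces disjoint by normal isotopies and count the pairs of a point of `F` and a
point of `G` on each edge, with a sign for their order along the edge. In a facet at this edge, two
arcs around different corners have a forced order, which gives the products of coordinates. Arcs
around the same corner are nested, so their contributions agree on the two edges at the corner and
cancel. The count on an edge is the same from both facets at it, which enter with opposite signs.
That disjoint arcs are ordered in this way is a planar crossing argument
(`exists_common_zero_of_sides`).

Now add over all tetrahedra. Glued facets cancel because the gluings respect the orientation, and
free facets off the two tori carry no arcs of `F`. Both triangles of a torus have the same
coordinates, so twice the form of `T₁` plus twice the form of `T₂` is zero
(`coordForm_add_coordForm`).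

The slope is read off from the coordinates. If coordinate `i` is smallest, the `i`-th number of
innermost arcs at each corner are vertex links. The class of an essential curve is then parallel to
an integral vector `v` that is linear in the coordinates (`exists_slopeVec`). This is proved without
tracing curves: `det(v, ·)`, as a function on the universal cover, becomes well defined on `S ∩ T`
after a correction constant on each arc, so it vanishes on the classes of closed curves in `S ∩ T`
(`isPotential_correction`, `apply_class_eq_zero`). Determinants of the vectors `v` are the
alternating form up to the sign of the basis. The opposite orientation conventions on the tori
compensate the opposite forms, so the two families of vectors have equal pairwise determinants and
are related by an element of `SL₂(ℚ)` (`exists_SL2_slopeQ`). -/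

noncomputable section

/-! ### Crossing paths in a triangle -/

namespace PlanarCrossing

open unitInterval

/-- A continuous choice of polar coordinates for a nowhere vanishing map on the square. -/
theorem exists_polar (f g : I × I → ℝ) (hf : Continuous f) (hg : Continuous g)
    (h : ∀ z, ¬ (f z = 0 ∧ g z = 0)) (θ₀ : ℝ) (z₀ : I × I) (r₀ : ℝ)
    (hr₀ : 0 < r₀) (hf₀ : f z₀ = r₀ * Real.cos θ₀) (hg₀ : g z₀ = r₀ * Real.sin θ₀) :
    ∃ θ ρ : I × I → ℝ, Continuous θ ∧ θ z₀ = θ₀ ∧ (∀ z, 0 < ρ z) ∧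
      (∀ z, f z = ρ z * Real.cos (θ z)) ∧ ∀ z, g z = ρ z * Real.sin (θ z) := by
  -- Clamping the coordinates extends the map to the plane, a simply connected and locally path
  -- connected domain on which lifts through `Complex.exp` exist.
  let p : ℝ × ℝ → I × I := fun z =>
    (Set.projIcc 0 1 zero_le_one z.1, Set.projIcc 0 1 zero_le_one z.2)
  let ι : I × I → ℝ × ℝ := fun z => (z.1, z.2)
  have hp : Continuous p := by fun_prop
  have hι : Continuous ι := by fun_prop
  have hpι : ∀ z, p (ι z) = z := fun z => by simp [p, ι]
  let F : C(ℝ × ℝ, ℂ) := ⟨fun z => ⟨f (p z), g (p z)⟩, by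
    have : (fun z => (⟨f (p z), g (p z)⟩ : ℂ))
        = fun z => (f (p z) : ℂ) + (g (p z) : ℂ) * Complex.I := by
      ext z; exact Complex.mk_eq_add_mul_I _ _
    rw [this]; fun_prop⟩
  have he : Complex.exp (⟨Real.log r₀, θ₀⟩ : ℂ) = F (ι z₀) := by
    apply Complex.ext
    · simp [F, Complex.exp_re, Real.exp_log hr₀, hf₀, hpι]
    · simp [F, Complex.exp_im, Real.exp_log hr₀, hg₀, hpι]
  obtain ⟨G, ⟨hG0, hG⟩, -⟩ := Complex.isCoveringMapOn_exp.existsUnique_continuousMap_lifts F he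
    (fun z hz => h (p z) ⟨congrArg Complex.re hz, congrArg Complex.im hz⟩)
  have key : ∀ z, Complex.exp (G (ι z)) = ⟨f z, g z⟩ := fun z => by
    have := congrFun hG (ι z)
    simpa [F, hpι] using this
  refine ⟨fun z => (G (ι z)).im, fun z => Real.exp (G (ι z)).re,
    Complex.continuous_im.comp (G.continuous.comp hι), ?_, fun z => Real.exp_pos _,
    fun z => ?_, fun z => ?_⟩
  · simp [hG0]
  · rw [← Complex.exp_re, key]
  · rw [← Complex.exp_im, key]

/-- If the angle stays in a closed half-plane, a weak lower bound at one point gives the sharp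
lower bound everywhere. -/
theorem angle_lower_bound (h : I → ℝ) (hc : Continuous h) (ψ : ℝ)
    (hcos : ∀ s, 0 ≤ Real.cos (h s - ψ)) (s t : I) (hs : ψ - 3 * Real.pi / 2 < h s) :
    ψ - Real.pi / 2 ≤ h t := by
  by_contra! ht
  have hneg : ∀ c, ψ - 3 * Real.pi / 2 < c → c < ψ - Real.pi / 2 → Real.cos (c - ψ) < 0 := by
    intro c h1 h2
    rw [← Real.cos_neg]
    apply Real.cos_neg_of_pi_div_two_lt_of_lt <;> linarith
  rcases lt_or_ge (h s) (ψ - Real.pi / 2) with h1 | h1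
  · exact absurd (hcos s) (not_le.2 (hneg _ hs h1))
  -- The maximum with `ψ - π` gives an intermediate value inside the gap where the cosine is
  -- negative, even if `h t` lies below the whole gap.
  · have hm : max (h t) (ψ - Real.pi) ∈ Set.uIcc (h t) (h s) := by
      rw [Set.uIcc_of_le (by linarith)]
      exact ⟨le_max_left _ _, max_le (by linarith) (by linarith [Real.pi_pos])⟩
    obtain ⟨c, -, hc'⟩ := intermediate_value_uIcc (a := t) (b := s) hc.continuousOn hm
    refine absurd (hcos c) (not_le.2 (hneg _ ?_ ?_))
    · rw [hc']; exact lt_max_of_lt_right (by linarith [Real.pi_pos])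
    · rw [hc']; exact max_lt ht (by linarith [Real.pi_pos])

theorem cos_sub_nonneg_of {ρ θ f g : ℝ} (hρ : 0 < ρ) (hf : f = ρ * Real.cos θ)
    (hg : g = ρ * Real.sin θ) (ψ : ℝ) (h : 0 ≤ f * Real.cos ψ + g * Real.sin ψ) :
    0 ≤ Real.cos (θ - ψ) := by
  rw [Real.cos_sub]
  have : f * Real.cos ψ + g * Real.sin ψ
      = ρ * (Real.cos θ * Real.cos ψ + Real.sin θ * Real.sin ψ) := by rw [hf, hg]; ring
  rw [this] at h
  exact nonneg_of_mul_nonneg_right h hρ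

/-- A pair of functions on the square whose signs on the sides force a nonzero winding
number around the boundary has a common zero. -/
theorem exists_common_zero_of_sides (f g : I × I → ℝ) (hf : Continuous f) (hg : Continuous g)
    (h00f : 0 < f (0, 0)) (h00g : g (0, 0) = 0) (hbot : ∀ s, 0 ≤ g (s, 0))
    (hright : ∀ t, f (1, t) ≤ 0) (hleft : ∀ t, g (0, t) ≤ 0)
    (htop : (∀ s, f (s, 1) + g (s, 1) ≤ 0) ∨
      ((∀ s, 0 ≤ f (s, 1)) ∧ f (1, 1) = 0 ∧ g (1, 1) < 0)) :
    ∃ z, f z = 0 ∧ g z = 0 := by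
  by_contra! hne
  have hπ := Real.pi_pos
  obtain ⟨θ, ρ, hθ, hθ0, hρ, hfθ, hgθ⟩ := exists_polar f g hf hg
    (fun z hz => hne z hz.1 hz.2) 0 (0, 0) (f (0, 0)) h00f (by simp) (by simp [h00g])
  have nn := fun z => cos_sub_nonneg_of (hρ z) (hfθ z) (hgθ z)
  have c1 : Real.cos (3 * Real.pi / 2) = 0 := by
    rw [show 3 * Real.pi / 2 = Real.pi / 2 + Real.pi by ring, Real.cos_add_pi]; simp
  have s1 : Real.sin (3 * Real.pi / 2) = -1 := by
    rw [show 3 * Real.pi / 2 = Real.pi / 2 + Real.pi by ring, Real.sin_add_pi]; simp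
  -- The angle is followed once around the square. The sides confine the vector to half-planes
  -- centred at the directions `π/2`, `π`, then `5π/4` or `2π`, then `3π/2`. The bounds propagate
  -- from corner to corner, and back at `(0, 0)` the angle 0 would have to be at least `π`.
  have b1 : Real.pi / 2 - Real.pi / 2 ≤ θ (1, 0) :=
    angle_lower_bound (fun s => θ (s, 0)) (by fun_prop) (Real.pi / 2)
      (fun s => nn _ _ (by simpa using hbot s)) 0 1 (by rw [hθ0]; linarith)
  have b2 : Real.pi - Real.pi / 2 ≤ θ (1, 1) :=
    angle_lower_bound (fun t => θ (1, t)) (by fun_prop) Real.pi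
      (fun s => nn _ _ (by simpa using hright s)) 0 1 (by linarith)
  have b3 : Real.pi / 2 < θ (0, 1) := by
    rcases htop with htop | ⟨htop, h11f, h11g⟩
    · have : 5 * Real.pi / 4 - Real.pi / 2 ≤ θ (0, 1) := by
        refine angle_lower_bound (fun s => θ (s, 1)) (by fun_prop) (5 * Real.pi / 4)
          (fun s => nn _ _ ?_) 1 0 (by linarith)
        rw [show 5 * Real.pi / 4 = Real.pi / 4 + Real.pi by ring, Real.cos_add_pi,
          Real.sin_add_pi, Real.cos_pi_div_four, Real.sin_pi_div_four]
        nlinarith [htop s, Real.sqrt_pos.2 (zero_lt_two (α := ℝ))]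
      linarith
    · have hs : Real.sin (θ (1, 1)) < 0 := by
        rw [hgθ] at h11g; exact neg_of_mul_neg_right h11g (hρ _).le
      have h1 : Real.pi < θ (1, 1) := by
        by_contra! hle
        exact absurd (Real.sin_nonneg_of_nonneg_of_le_pi (by linarith) hle) (not_le.2 hs)
      have : 2 * Real.pi - Real.pi / 2 ≤ θ (0, 1) :=
        angle_lower_bound (fun s => θ (s, 1)) (by fun_prop) (2 * Real.pi)
          (fun s => nn _ _ (by simpa using htop s)) 1 0 (by linarith)
      linarith
  have b4 : 3 * Real.pi / 2 - Real.pi / 2 ≤ θ (0, 0) :=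
    angle_lower_bound (fun t => θ (0, t)) (by fun_prop) (3 * Real.pi / 2)
      (fun s => nn _ _ (by rw [c1, s1]; simpa using hleft s)) 1 0 (by linarith)
  linarith

end PlanarCrossing

/-! ### Vectors with the same determinants -/

namespace SlopeAlgebra

/-- The slope of a vector in `ℚ²`. -/
def slopeQ (v : ℚ × ℚ) : OnePoint ℚ := if v.2 = 0 then ∞ else ((v.1 / v.2 : ℚ) : OnePoint ℚ)

/-- The determinant of two vectors. -/
def det2 {R : Type*} [CommRing R] (v w : R × R) : R := v.1 * w.2 - v.2 * w.1

theorem slopeQ_eq_of_det_eq_zero {v w : ℚ × ℚ} (hv : v ≠ 0) (hw : w ≠ 0) (h : det2 v w = 0) :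
    slopeQ v = slopeQ w := by
  obtain ⟨a, b⟩ := v
  obtain ⟨c, d⟩ := w
  simp only [det2] at h
  simp only [slopeQ]
  by_cases hb : b = 0
  · subst hb
    have ha : a ≠ 0 := by rintro rfl; exact hv rfl
    have : d = 0 := by simpa [ha] using h
    simp [this]
  · by_cases hd : d = 0
    · subst hd
      have hc : c ≠ 0 := by rintro rfl; exact hw rfl
      simp [hb, hc] at h
    · simp only [hb, hd, if_false]
      congr 1
      field_simp
      linarith

theorem smul_slopeQ (Φ : SL(2, ℚ)) {v : ℚ × ℚ} (hv : v ≠ 0) :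
    (Φ : GL (Fin 2) ℚ) • slopeQ v
      = slopeQ (Φ 0 0 * v.1 + Φ 0 1 * v.2, Φ 1 0 * v.1 + Φ 1 1 * v.2) := by
  obtain ⟨a, b⟩ := v
  by_cases hb : b = 0
  · subst hb
    have ha : a ≠ 0 := by rintro rfl; exact hv rfl
    simp only [slopeQ, if_true, OnePoint.smul_infty_eq_ite]
    by_cases h : Φ 1 0 = 0
    · simp [h]
    · simp [h, ha, mul_div_mul_right]
  · simp only [slopeQ, hb, if_false, OnePoint.smul_some_eq_ite]
    have e : Φ 1 0 * (a / b) + Φ 1 1 = (Φ 1 0 * a + Φ 1 1 * b) / b := by field_simp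
    have e' : Φ 0 0 * (a / b) + Φ 0 1 = (Φ 0 0 * a + Φ 0 1 * b) / b := by field_simp
    simp only [Matrix.SpecialLinearGroup.coe_GL_coe_matrix, e, e', div_eq_zero_iff, hb, or_false]
    by_cases h : Φ 1 0 * a + Φ 1 1 * b = 0
    · simp [h]
    · simp only [h, if_false]
      congr 1
      field_simp

/-- A vector with a prescribed determinant against a nonzero vector. -/
theorem exists_det_eq_one {v : ℚ × ℚ} (hv : v ≠ 0) : ∃ w, det2 v w = 1 := by
  obtain ⟨a, b⟩ := v
  by_cases hb : b = 0
  · subst hb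
    have ha : a ≠ 0 := by rintro rfl; exact hv rfl
    exact ⟨(0, a⁻¹), by simp [det2, ha]⟩
  · exact ⟨(-b⁻¹, 0), by simp [det2, hb]⟩

/-- The matrix in `SL₂` that takes one pair of vectors to another pair with the same nonzero
determinant. -/
theorem exists_SL2_of_det_eq {v w v' w' : ℚ × ℚ} (h : det2 v' w' = det2 v w)
    (h0 : det2 v w ≠ 0) :
    ∃ Φ : SL(2, ℚ), ∀ u u' : ℚ × ℚ, det2 v' u' = det2 v u → det2 w' u' = det2 w u →
      (Φ 0 0 * u.1 + Φ 0 1 * u.2, Φ 1 0 * u.1 + Φ 1 1 * u.2) = u' := by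
  obtain ⟨a, b⟩ := v
  obtain ⟨c, d⟩ := w
  obtain ⟨a', b'⟩ := v'
  obtain ⟨c', d'⟩ := w'
  simp only [det2] at h h0
  obtain ⟨D, hD⟩ : ∃ D, D = a * d - b * c := ⟨_, rfl⟩
  rw [← hD] at h h0
  -- This is the matrix with columns `v'`, `w'` times the inverse of the one with columns `v`, `w`.
  have hdet : (!![(a' * d - c' * b) / D, (-a' * c + c' * a) / D;
      (b' * d - d' * b) / D, (-b' * c + d' * a) / D] : Matrix (Fin 2) (Fin 2) ℚ).det = 1 := by
    rw [Matrix.det_fin_two_of]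
    field_simp
    linear_combination (a * d - b * c) * h - D * hD
  refine ⟨⟨_, hdet⟩, ?_⟩
  rintro ⟨x, y⟩ ⟨x', y'⟩ h1 h2
  simp only [det2] at h1 h2
  simp only [Matrix.of_apply, Matrix.cons_val', Matrix.cons_val_zero, Matrix.cons_val_one,
    Matrix.cons_val_fin_one, Prod.mk.injEq]
  constructor
  · field_simp
    linear_combination a' * h2 - c' * h1 + x' * h
  · field_simp
    linear_combination b' * h2 - d' * h1 + y' * h

/-- Two families of nonzero vectors with the same pairwise determinants have slopes that are
related by an element of `SL₂(ℚ)`. -/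
theorem exists_SL2_slopeQ {ι : Type*} (P : ι → Prop) (v₁ v₂ : ι → ℚ × ℚ)
    (h₁ : ∀ i, P i → v₁ i ≠ 0) (h₂ : ∀ i, P i → v₂ i ≠ 0)
    (h : ∀ i j, P i → P j → det2 (v₁ i) (v₁ j) = det2 (v₂ i) (v₂ j)) :
    ∃ Φ : SL(2, ℚ), ∀ i, P i → (Φ : GL (Fin 2) ℚ) • slopeQ (v₂ i) = slopeQ (v₁ i) := by
  by_cases hex : ∃ i j, P i ∧ P j ∧ det2 (v₂ i) (v₂ j) ≠ 0
  · obtain ⟨i, j, hi, hj, hij⟩ := hex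
    obtain ⟨Φ, hΦ⟩ := exists_SL2_of_det_eq (h i j hi hj) hij
    refine ⟨Φ, fun k hk => ?_⟩
    rw [smul_slopeQ _ (h₂ k hk), hΦ _ _ (h i k hi hk) (h j k hj hk)]
  -- All determinants vanish, so each family has a single slope. Completing one vector and its
  -- partner to pairs of determinant 1 gives a matrix that carries one to the other.
  · push Not at hex
    by_cases hne : ∃ i, P i
    · obtain ⟨i, hi⟩ := hne
      obtain ⟨w₁, hw₁⟩ := exists_det_eq_one (h₁ i hi)
      obtain ⟨w₂, hw₂⟩ := exists_det_eq_one (h₂ i hi)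
      obtain ⟨Φ, hΦ⟩ := exists_SL2_of_det_eq (hw₁.trans hw₂.symm) (by rw [hw₂]; exact one_ne_zero)
      refine ⟨Φ, fun k hk => ?_⟩
      have e₂ : slopeQ (v₂ k) = slopeQ (v₂ i) :=
        (slopeQ_eq_of_det_eq_zero (h₂ i hi) (h₂ k hk) (hex i k hi hk)).symm
      have e₁ : slopeQ (v₁ k) = slopeQ (v₁ i) :=
        (slopeQ_eq_of_det_eq_zero (h₁ i hi) (h₁ k hk) ((h i k hi hk).trans (hex i k hi hk))).symm
      rw [e₁, e₂, smul_slopeQ _ (h₂ i hi), hΦ (v₂ i) (v₁ i)]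
      · simp [det2, mul_comm]
      · have a1 : det2 w₁ (v₁ i) = - det2 (v₁ i) w₁ := by simp only [det2]; ring
        have a2 : det2 w₂ (v₂ i) = - det2 (v₂ i) w₂ := by simp only [det2]; ring
        rw [a1, a2, hw₁, hw₂]
    · exact ⟨1, fun k hk => absurd ⟨k, hk⟩ hne⟩

end SlopeAlgebra

namespace NormalSurf

open unitInterval

/-! ### Barycentric coordinates -/

/-- Convention for the hypothesis `[k, v, u, w].Nodup`: `k` names a facet by its opposite vertex,
and `v`, `u`, `w` are its corners. The edge on which `k` and `w` vanish joins `v` to `u`. -/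
theorem univ_eq_of_nodup {k v u w : Fin 4} (h : [k, v, u, w].Nodup) :
    (Finset.univ : Finset (Fin 4)) = {k, v, u, w} := by
  revert k v u w; decide

theorem eq_of_nodup {k v u w : Fin 4} (h : [k, v, u, w].Nodup) (i : Fin 4) :
    i = k ∨ i = v ∨ i = u ∨ i = w := by
  have := Finset.mem_univ i
  rw [univ_eq_of_nodup h] at this
  simpa using this

theorem exists_nodup {k v : Fin 4} (h : k ≠ v) : ∃ u w, [k, v, u, w].Nodup := by
  revert k v; decide

theorem exists_nodup₃ {k v u : Fin 4} (h : [k, v, u].Nodup) : ∃ w, [k, v, u, w].Nodup := by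
  revert k v u; decide

theorem nodup_swap {k v u w : Fin 4} (h : [k, v, u, w].Nodup) : [k, v, w, u].Nodup := by
  revert k v u w; decide

theorem nodup_swap' {k v u w : Fin 4} (h : [k, v, u, w].Nodup) : [k, u, v, w].Nodup := by
  revert k v u w; decide

theorem tetra_sum {k v u w : Fin 4} (h : [k, v, u, w].Nodup) (x : Tetra) :
    x k + x v + x u + x w = 1 := by
  have := stdSimplex.sum_eq_one x
  rw [univ_eq_of_nodup h] at this
  simp only [List.nodup_cons, List.mem_cons, not_or, List.not_mem_nil] at h
  rw [Finset.sum_insert (by simp [h]), Finset.sum_insert (by simp [h]),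
    Finset.sum_insert (by simp [h]), Finset.sum_singleton] at this
  linarith

theorem tetra_ext {k v u w : Fin 4} (h : [k, v, u, w].Nodup) {x y : Tetra}
    (hk : x k = y k) (hu : x u = y u) (hw : x w = y w) : x = y := by
  have h1 := tetra_sum h x
  have h2 := tetra_sum h y
  ext i
  rcases eq_of_nodup h i with rfl | rfl | rfl | rfl <;> linarith

theorem continuous_coord (i : Fin 4) : Continuous fun x : Tetra => x i :=
  (continuous_apply i).comp continuous_subtype_val

theorem mem_zeros {x : Tetra} {i : Fin 4} : i ∈ zeros x ↔ x i = 0 := Iff.rfl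

/-! ### Normal arcs -/

theorem nodup_eq_or {k v u w u' w' : Fin 4} (h : [k, v, u, w].Nodup) (h' : [k, v, u', w'].Nodup) :
    u' = u ∧ w' = w ∨ u' = w ∧ w' = u := by
  revert k v u w u' w'; decide

/-- Reversing the path exchanges `u` and `w`, so the labelling hidden in the definition can be
prescribed. -/
theorem IsNormalArc.exists_path {k v : Fin 4} {A : Set Tetra} (hA : IsNormalArc k v A)
    {u w : Fin 4} (h : [k, v, u, w].Nodup) :
    ∃ γ : I → Tetra, Continuous γ ∧ Function.Injective γ ∧ Set.range γ = A ∧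
      zeros (γ 0) = {k, u} ∧ zeros (γ 1) = {k, w} ∧ ∀ s, 0 < s → s < 1 → zeros (γ s) = {k} := by
  obtain ⟨u', w', h', γ, hc, hi, hr, h0, h1, hs⟩ := hA
  rcases nodup_eq_or h h' with ⟨rfl, rfl⟩ | ⟨rfl, rfl⟩
  · exact ⟨γ, hc, hi, hr, h0, h1, hs⟩
  · refine ⟨γ ∘ σ, hc.comp continuous_symm, hi.comp symm_bijective.injective, ?_, ?_, ?_, ?_⟩
    · rw [symm_bijective.surjective.range_comp, hr]
    · simpa using h1
    · simpa using h0
    · intro s h0s hs1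
      exact hs _ (by rwa [unitInterval.lt_symm_comm, symm_zero])
        (by rwa [unitInterval.symm_lt_comm, symm_one])

namespace IsNormalArc

variable {k v u w : Fin 4} {A B : Set Tetra}

theorem ne (hA : IsNormalArc k v A) : k ≠ v := by
  obtain ⟨u, w, h, -⟩ := hA
  simp at h; tauto

theorem isConnected (hA : IsNormalArc k v A) : IsConnected A := by
  obtain ⟨u, w, h, γ, hc, hi, rfl, -⟩ := hA
  exact isConnected_range hc

theorem isCompact (hA : IsNormalArc k v A) : IsCompact A := by
  obtain ⟨u, w, h, γ, hc, hi, rfl, -⟩ := hA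
  exact isCompact_range hc

theorem zeros_eq (hA : IsNormalArc k v A) {x : Tetra} (hx : x ∈ A) :
    zeros x = {k} ∨ ∃ c, c ≠ k ∧ c ≠ v ∧ zeros x = {k, c} := by
  obtain ⟨u, w, h, γ, hc, hi, rfl, h0, h1, hs⟩ := hA
  obtain ⟨s, rfl⟩ := hx
  simp only [List.nodup_cons, List.mem_cons, not_or, List.not_mem_nil] at h
  rcases eq_or_lt_of_le (nonneg' (t := s)) with rfl | h0s
  · exact .inr ⟨u, Ne.symm h.1.2.1, Ne.symm h.2.1.1, h0⟩
  rcases eq_or_lt_of_le (le_one' (t := s)) with rfl | hs1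
  · exact .inr ⟨w, Ne.symm h.1.2.2.1, Ne.symm h.2.1.2.1, h1⟩
  exact .inl (hs s h0s hs1)

theorem apply_eq_zero (hA : IsNormalArc k v A) {x : Tetra} (hx : x ∈ A) : x k = 0 := by
  rw [← mem_zeros]
  rcases hA.zeros_eq hx with h | ⟨c, -, -, h⟩ <;> simp [h]

theorem zeros_ne (hA : IsNormalArc k v A) {x : Tetra} (hx : x ∈ A) : zeros x ≠ {k, v} := by
  intro h
  have hv : v ∈ zeros x := by simp [h]
  have := hA.ne
  rcases hA.zeros_eq hx with h' | ⟨c, hc, hcv, h'⟩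
  · rw [h'] at hv; exact this hv.symm
  · rw [h'] at hv
    rcases hv with rfl | rfl
    · exact this rfl
    · exact hcv rfl

/-- A normal arc has exactly one end on each of the two edges of the triangle at its corner. -/
theorem existsUnique_end (hA : IsNormalArc k v A) (hu : u ≠ k) (huv : u ≠ v) :
    ∃! x, x ∈ A ∧ zeros x = {k, u} := by
  obtain ⟨w, h⟩ := exists_nodup₃ (k := k) (v := v) (u := u)
    (by simp [hA.ne, hu.symm, huv.symm])
  obtain ⟨γ, hc, hi, rfl, h0, h1, hs⟩ := hA.exists_path h
  refine ⟨γ 0, ⟨⟨0, rfl⟩, h0⟩, ?_⟩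
  rintro _ ⟨⟨s, rfl⟩, hsz⟩
  rcases eq_or_lt_of_le (nonneg' (t := s)) with rfl | h0s
  · rfl
  have hmem : u ∈ zeros (γ s) := by simp [hsz]
  exfalso
  simp only [List.nodup_cons, List.mem_cons, not_or, List.not_mem_nil] at h
  rcases eq_or_lt_of_le (le_one' (t := s)) with rfl | hs1
  · rw [h1] at hmem
    rcases hmem with rfl | rfl <;> simp at h
  · rw [hs s h0s hs1] at hmem
    exact hu hmem

theorem corner_unique {v' : Fin 4} (hA : IsNormalArc k v A) (hA' : IsNormalArc k v' A) :
    v = v' := by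
  by_contra hne
  obtain ⟨x, ⟨hx, hz⟩, -⟩ := hA.existsUnique_end hA'.ne.symm (Ne.symm hne)
  exact hA'.zeros_ne hx hz

/-- A normal arc that contains another normal arc is equal to it. -/
theorem eq_of_subset {v' : Fin 4} (hA : IsNormalArc k v A) (hB : IsNormalArc k v' B)
    (hAB : A ⊆ B) : A = B := by
  obtain ⟨u, w, h, γ, hc, hi, rfl, h0, h1, hs⟩ := hA
  obtain ⟨u', w', h', δ, hc', hi', rfl, h0', h1', hs'⟩ := hB
  have hemb : Topology.IsEmbedding δ := (hc'.isClosedEmbedding hi').isEmbedding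
  -- The smaller arc, read in the parameter of the larger one, is a continuous self-map of the
  -- interval that takes ends to ends. It is onto by the intermediate value theorem.
  choose e he using fun s => hAB ⟨s, rfl⟩
  have hec : Continuous e := by
    rw [hemb.continuous_iff]
    convert hc using 1
    exact funext he
  have hend : ∀ s c, c ≠ k → zeros (γ s) = {k, c} → e s = 0 ∨ e s = 1 := by
    intro s c hck hz
    by_contra! hne
    have := hs' (e s) (lt_of_le_of_ne nonneg' hne.1.symm) (lt_of_le_of_ne le_one' hne.2)
    rw [he, hz] at this
    have hcm : c ∈ ({k} : Set (Fin 4)) := this ▸ (by simp)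
    exact hck hcm
  simp only [List.nodup_cons, List.mem_cons, not_or, List.not_mem_nil] at h
  have hne : e 0 ≠ e 1 := by
    intro heq
    have : γ 0 = γ 1 := by rw [← he, ← he, heq]
    exact zero_ne_one (hi this)
  have hsurj : Function.Surjective e := by
    intro t
    have hmem : t ∈ Set.uIcc (e 0) (e 1) := by
      rcases hend 0 u (Ne.symm h.1.2.1) h0 with a | a <;>
        rcases hend 1 w (Ne.symm h.1.2.2.1) h1 with b | b
      · exact absurd (a.trans b.symm) hne
      · rw [a, b, Set.uIcc_of_le zero_le_one]; exact ⟨nonneg', le_one'⟩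
      · rw [a, b, Set.uIcc_of_ge zero_le_one]; exact ⟨nonneg', le_one'⟩
      · exact absurd (a.trans b.symm) hne
    obtain ⟨s, -, hs⟩ := intermediate_value_uIcc hec.continuousOn hmem
    exact ⟨s, hs⟩
  refine Set.Subset.antisymm hAB ?_
  rintro _ ⟨t, rfl⟩
  obtain ⟨s, rfl⟩ := hsurj t
  exact ⟨s, (he s).symm⟩

/-- The image of a normal arc under an embedding that preserves the open faces. -/
theorem image {X : Set Tetra} (hA : IsNormalArc k v A) (hAX : A ⊆ X) (f : X → Tetra)
    (hf : Continuous f) (hinj : Function.Injective f) (hz : ∀ x, zeros (f x) = zeros x.1) :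
    IsNormalArc k v (f '' (Subtype.val ⁻¹' A)) := by
  obtain ⟨u, w, h, γ, hc, hi, rfl, h0, h1, hs⟩ := hA
  have hmem : ∀ s, γ s ∈ X := fun s => hAX ⟨s, rfl⟩
  refine ⟨u, w, h, fun s => f ⟨γ s, hmem s⟩, hf.comp (hc.subtype_mk _), ?_, ?_, ?_, ?_, ?_⟩
  · intro s t hst
    exact hi (congrArg Subtype.val (hinj hst))
  · ext y
    constructor
    · rintro ⟨s, rfl⟩
      exact ⟨⟨γ s, hmem s⟩, ⟨s, rfl⟩, rfl⟩
    · rintro ⟨x, ⟨s, hs⟩, rfl⟩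
      exact ⟨s, congrArg f (Subtype.ext hs)⟩
  · simpa [hz] using h0
  · simpa [hz] using h1
  · intro s h0s hs1
    simpa [hz] using hs s h0s hs1

/-- Two disjoint normal arcs around the same corner are nested: their ends are in the same order
on both edges. -/
theorem lt_of_disjoint (h : [k, v, u, w].Nodup) (hA : IsNormalArc k v A) (hB : IsNormalArc k v B)
    (hAB : Disjoint A B) {p q p' q' : Tetra} (hp : p ∈ A) (hq : q ∈ B) (hp' : p' ∈ A)
    (hq' : q' ∈ B) (hpz : zeros p = {k, w}) (hqz : zeros q = {k, w}) (hpz' : zeros p' = {k, u})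
    (hqz' : zeros q' = {k, u}) (hlt : q u < p u) : q' w < p' w := by
  have hd := Set.disjoint_left.1 hAB
  have huk : u ≠ k ∧ u ≠ v ∧ w ≠ k ∧ w ≠ v := by
    simp only [List.nodup_cons, List.mem_cons, not_or, List.not_mem_nil] at h; grind
  obtain ⟨α, hαc, -, hα, hα0, hα1, -⟩ := hA.exists_path (nodup_swap h)
  obtain ⟨β, hβc, -, hβ, hβ0, hβ1, -⟩ := hB.exists_path (nodup_swap h)
  have hαA : ∀ s, α s ∈ A := fun s => hα ▸ ⟨s, rfl⟩
  have hβB : ∀ s, β s ∈ B := fun s => hβ ▸ ⟨s, rfl⟩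
  obtain rfl : α 0 = p := (hA.existsUnique_end huk.2.2.1 huk.2.2.2).unique ⟨hαA 0, hα0⟩ ⟨hp, hpz⟩
  obtain rfl : β 0 = q := (hB.existsUnique_end huk.2.2.1 huk.2.2.2).unique ⟨hβB 0, hβ0⟩ ⟨hq, hqz⟩
  obtain rfl : α 1 = p' := (hA.existsUnique_end huk.1 huk.2.1).unique ⟨hαA 1, hα1⟩ ⟨hp', hpz'⟩
  obtain rfl : β 1 = q' := (hB.existsUnique_end huk.1 huk.2.1).unique ⟨hβB 1, hβ1⟩ ⟨hq', hqz'⟩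
  have a0 : α 0 w = 0 := mem_zeros.1 (by simp [hα0])
  have a1 : α 1 u = 0 := mem_zeros.1 (by simp [hα1])
  have b0 : β 0 w = 0 := mem_zeros.1 (by simp [hβ0])
  have b1 : β 1 u = 0 := mem_zeros.1 (by simp [hβ1])
  have eqAB : ∀ s t, α s u = β t u → α s w = β t w → False := fun s t h1 h2 => by
    refine hd (hαA s) ?_
    rw [tetra_ext h (x := α s) (y := β t) (by rw [hA.apply_eq_zero (hαA s),
      hB.apply_eq_zero (hβB t)]) h1 h2]
    exact hβB t
  have cu := continuous_coord u
  have cw := continuous_coord w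
  by_contra! hle
  -- In the plane of the facet, `u` and `w` are coordinates. A common zero of the two coordinate
  -- differences is a point on both arcs.
  obtain ⟨⟨s, t⟩, h1, h2⟩ := PlanarCrossing.exists_common_zero_of_sides
    (fun z => α z.1 u - β z.2 u) (fun z => α z.1 w - β z.2 w)
    ((cu.comp (hαc.comp continuous_fst)).sub (cu.comp (hβc.comp continuous_snd)))
    ((cw.comp (hαc.comp continuous_fst)).sub (cw.comp (hβc.comp continuous_snd)))
    (by simpa using hlt) (by simp [a0, b0])
    (fun s => by simp [b0]) (fun t => by simp [a1]) (fun t => by simp [a0])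
    (.inr ⟨fun s => by simp [b1], by simp [a1, b1], by
      have : α 1 w ≠ β 1 w := fun e => eqAB 1 1 (a1.trans b1.symm) e
      simpa using lt_of_le_of_ne hle this⟩)
  exact eqAB s t (sub_eq_zero.1 h1) (sub_eq_zero.1 h2)

/-- The ends of two disjoint normal arcs around different corners on the common edge: the arc
around `v` is nearer to `v`. -/
theorem lt_of_disjoint' (h : [k, v, u, w].Nodup) (hA : IsNormalArc k v A) (hB : IsNormalArc k u B)
    (hAB : Disjoint A B) {p q : Tetra} (hp : p ∈ A) (hq : q ∈ B)
    (hpz : zeros p = {k, w}) (hqz : zeros q = {k, w}) : p u < q u := by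
  have hd := Set.disjoint_left.1 hAB
  have huk : w ≠ k ∧ w ≠ v ∧ w ≠ u := by
    simp only [List.nodup_cons, List.mem_cons, not_or, List.not_mem_nil] at h; grind
  obtain ⟨α, hαc, -, hα, hα0, hα1, -⟩ := hA.exists_path (nodup_swap h)
  obtain ⟨β, hβc, -, hβ, hβ0, hβ1, -⟩ := hB.exists_path (nodup_swap (nodup_swap' h))
  have hαA : ∀ s, α s ∈ A := fun s => hα ▸ ⟨s, rfl⟩
  have hβB : ∀ s, β s ∈ B := fun s => hβ ▸ ⟨s, rfl⟩
  obtain rfl : α 0 = p := (hA.existsUnique_end huk.1 huk.2.1).unique ⟨hαA 0, hα0⟩ ⟨hp, hpz⟩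
  obtain rfl : β 0 = q := (hB.existsUnique_end huk.1 huk.2.2).unique ⟨hβB 0, hβ0⟩ ⟨hq, hqz⟩
  have a0 : α 0 w = 0 := mem_zeros.1 (by simp [hα0])
  have a1 : α 1 u = 0 := mem_zeros.1 (by simp [hα1])
  have b0 : β 0 w = 0 := mem_zeros.1 (by simp [hβ0])
  have b1 : β 1 v = 0 := mem_zeros.1 (by simp [hβ1])
  have eqAB : ∀ s t, α s u = β t u → α s w = β t w → False := fun s t h1 h2 => by
    refine hd (hαA s) ?_
    rw [tetra_ext h (x := α s) (y := β t) (by rw [hA.apply_eq_zero (hαA s),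
      hB.apply_eq_zero (hβB t)]) h1 h2]
    exact hβB t
  have cu := continuous_coord u
  have cw := continuous_coord w
  by_contra! hle
  obtain ⟨⟨s, t⟩, h1, h2⟩ := PlanarCrossing.exists_common_zero_of_sides
    (fun z => α z.1 u - β z.2 u) (fun z => α z.1 w - β z.2 w)
    ((cu.comp (hαc.comp continuous_fst)).sub (cu.comp (hβc.comp continuous_snd)))
    ((cw.comp (hαc.comp continuous_fst)).sub (cw.comp (hβc.comp continuous_snd)))
    (by
      have : β 0 u ≠ α 0 u := fun e => eqAB 0 0 e.symm (a0.trans b0.symm)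
      simpa using lt_of_le_of_ne hle this) (by simp [a0, b0])
    (fun s => by simp [b0]) (fun t => by simp [a1]) (fun t => by simp [a0])
    -- `β` ends on the edge opposite to `v`, where the sum of the coordinates `u` and `w` has its
    -- maximum 1.
    (.inl fun s => by
      have e1 := tetra_sum h (β 1)
      have e2 := tetra_sum h (α s)
      have e3 := hB.apply_eq_zero (hβB 1)
      have e4 := stdSimplex.zero_le (α s) v
      have e5 := stdSimplex.zero_le (α s) k
      simp only; linarith)
  exact eqAB s t (sub_eq_zero.1 h1) (sub_eq_zero.1 h2)

end IsNormalArc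

/-! ### Systems of normal arcs in a facet -/

/-- The normal arcs in `X` that cut off the corner `v` of the facet `k`. -/
def normalArcs (k v : Fin 4) (X : Set Tetra) : Set (Set Tetra) := {A | IsNormalArc k v A ∧ A ⊆ X}

/-- `X` meets the facet `k` in finitely many disjoint normal arcs. -/
structure IsArcSystem (k : Fin 4) (X : Set Tetra) : Prop where
  finite : ∀ v, (normalArcs k v X).Finite
  disjoint : ∀ v v' A B, A ∈ normalArcs k v X → B ∈ normalArcs k v' X → A ≠ B → Disjoint A B
  cover : ∀ x ∈ X, x k = 0 → ∃ v, ∃ A ∈ normalArcs k v X, x ∈ A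

section

variable {k : Fin 4} {X : Set Tetra} {F : Set (Set Tetra)}

/-- A connected subset of a finite disjoint union of closed arcs lies in one of them, and nested
normal arcs are equal. So any decomposition into arcs consists of all the normal arcs in `X`, and
counting them is unambiguous. -/
theorem mem_of_normalArc_subset (hF : F.Finite) (hd : F.PairwiseDisjoint id)
    (hn : ∀ A ∈ F, ∃ v, IsNormalArc k v A) (hX : X ∩ facet k = ⋃₀ F) {v : Fin 4} {A : Set Tetra}
    (hA : IsNormalArc k v A) (hAX : A ⊆ X) : A ∈ F := by
  have hAF : A ⊆ ⋃₀ F := by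
    rw [← hX]; exact fun x hx => ⟨hAX hx, hA.apply_eq_zero hx⟩
  obtain ⟨x, hx⟩ := hA.isConnected.nonempty
  obtain ⟨B, hB, hxB⟩ := hAF hx
  have hclosed : ∀ C ∈ F, IsClosed C := fun C hC => by
    obtain ⟨v', h'⟩ := hn C hC
    exact h'.isCompact.isClosed
  have hu : IsClosed (⋃₀ (F \ {B})) := by
    rw [Set.sUnion_eq_biUnion]
    exact (hF.subset Set.sdiff_subset).isClosed_biUnion fun C hC => hclosed C hC.1
  have hdis : Disjoint B (⋃₀ (F \ {B})) := by
    rw [Set.disjoint_sUnion_right]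
    intro C hC
    exact hd hB hC.1 (Ne.symm hC.2)
  have hsub := isPreconnected_iff_subset_of_disjoint_closed.1 hA.isConnected.isPreconnected
    B (⋃₀ (F \ {B})) (hclosed B hB) hu (by
      intro y hy
      obtain ⟨C, hC, hyC⟩ := hAF hy
      by_cases hCB : C = B
      · exact .inl (hCB ▸ hyC)
      · exact .inr ⟨C, ⟨hC, hCB⟩, hyC⟩)
      (by rw [hdis.inter_eq]; simp)
  obtain ⟨v', hB'⟩ := hn B hB
  rcases hsub with hsub | hsub
  · rwa [hA.eq_of_subset hB' hsub]
  · exact absurd (hsub hx) (Set.disjoint_left.1 hdis hxB)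

theorem normalArcs_eq_of_sUnion (hF : F.Finite) (hd : F.PairwiseDisjoint id)
    (hn : ∀ A ∈ F, ∃ v, IsNormalArc k v A) (hX : X ∩ facet k = ⋃₀ F) (v : Fin 4) :
    normalArcs k v X = {A ∈ F | IsNormalArc k v A} := by
  ext A
  constructor
  · rintro ⟨hA, hAX⟩
    exact ⟨mem_of_normalArc_subset hF hd hn hX hA hAX, hA⟩
  · rintro ⟨hAF, hA⟩
    refine ⟨hA, fun x hx => ?_⟩
    have : x ∈ X ∩ facet k := hX ▸ ⟨A, hAF, hx⟩
    exact this.1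

theorem isArcSystem_of_sUnion (hF : F.Finite) (hd : F.PairwiseDisjoint id)
    (hn : ∀ A ∈ F, ∃ v, IsNormalArc k v A) (hX : X ∩ facet k = ⋃₀ F) : IsArcSystem k X := by
  have key := normalArcs_eq_of_sUnion hF hd hn hX
  refine ⟨fun v => ?_, fun v v' A B hA hB hAB => ?_, fun x hx hxk => ?_⟩
  · rw [key]; exact hF.subset (Set.sep_subset _ _)
  · rw [key] at hA hB; exact hd hA.1 hB.1 hAB
  · obtain ⟨A, hA, hxA⟩ : x ∈ ⋃₀ F := hX ▸ ⟨hx, hxk⟩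
    obtain ⟨v, hv⟩ := hn A hA
    exact ⟨v, A, by rw [key]; exact ⟨hA, hv⟩, hxA⟩

theorem IsArcSystem.sUnion (hX : IsArcSystem k X) :
    X ∩ facet k = ⋃₀ (⋃ v, normalArcs k v X) := by
  ext x
  constructor
  · rintro ⟨hx, hxk⟩
    obtain ⟨v, A, hA, hxA⟩ := hX.cover x hx hxk
    exact ⟨A, Set.mem_iUnion.2 ⟨v, hA⟩, hxA⟩
  · rintro ⟨A, hA, hxA⟩
    obtain ⟨v, hA⟩ := Set.mem_iUnion.1 hA
    exact ⟨hA.2 hxA, hA.1.apply_eq_zero hxA⟩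

theorem IsNormalLoopCollection.isArcSystem (hX : IsNormalLoopCollection X) (k : Fin 4) :
    IsArcSystem k X := by
  obtain ⟨L, hL, hLd, hLn, rfl⟩ := hX
  choose! G hG using fun l hl => (hLn l hl).2.2 k
  have hsub : ∀ l ∈ L, ∀ A ∈ G l, A ⊆ l := fun l hl A hA x hx => by
    have : x ∈ l ∩ facet k := (hG l hl).2.2.2 ▸ ⟨A, hA, hx⟩
    exact this.1
  refine isArcSystem_of_sUnion (F := ⋃ l ∈ L, G l) (hL.biUnion fun l hl => (hG l hl).1) ?_ ?_ ?_
  · intro A hA B hB hAB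
    simp only [Set.mem_iUnion] at hA hB
    obtain ⟨l, hl, hA⟩ := hA
    obtain ⟨l', hl', hB⟩ := hB
    by_cases hll : l = l'
    · subst hll
      exact (hG l hl).2.1 hA hB hAB
    · exact (hLd hl hl' hll).mono (hsub l hl A hA) (hsub l' hl' B hB)
  · intro A hA
    simp only [Set.mem_iUnion] at hA
    obtain ⟨l, hl, hA⟩ := hA
    exact (hG l hl).2.2.1 A hA
  · ext x
    constructor
    · rintro ⟨⟨l, hl, hxl⟩, hxk⟩
      have : x ∈ ⋃₀ G l := (hG l hl).2.2.2 ▸ ⟨hxl, hxk⟩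
      obtain ⟨A, hA, hxA⟩ := this
      exact ⟨A, Set.mem_biUnion hl hA, hxA⟩
    · rintro ⟨A, hA, hxA⟩
      simp only [Set.mem_iUnion] at hA
      obtain ⟨l, hl, hA⟩ := hA
      have : x ∈ l ∩ facet k := (hG l hl).2.2.2 ▸ ⟨A, hA, hxA⟩
      exact ⟨⟨l, hl, this.1⟩, this.2⟩

/-- Normal isotopies preserve systems of normal arcs and the numbers of arcs. -/
theorem NormallyIsotopic.isArcSystem {Y : Set Tetra} (hXY : NormallyIsotopic X Y)
    (hX : IsArcSystem k X) :
    IsArcSystem k Y ∧ ∀ v, (normalArcs k v Y).ncard = (normalArcs k v X).ncard := by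
  obtain ⟨H, hH, hinj, -, hz, rfl⟩ := hXY
  -- Only the final map matters: it is a continuous injection that keeps every point in its open
  -- face, so arcs go to arcs around the same corner.
  obtain ⟨f, hfd⟩ : ∃ f : X → Tetra, f = fun x => H (1, x) := ⟨_, rfl⟩
  have hf : Continuous f := by rw [hfd]; fun_prop
  have hfi : Function.Injective f := by rw [hfd]; exact hinj 1
  have hfz : ∀ x, zeros (f x) = zeros x.1 := by rw [hfd]; exact hz 1
  rw [← hfd]
  let im : Set Tetra → Set Tetra := fun A => f '' (Subtype.val ⁻¹' A)
  have him : ∀ v A, A ∈ normalArcs k v X → IsNormalArc k v (im A) := fun v A hA =>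
    hA.1.image hA.2 f hf hfi hfz
  have hF : (im '' ⋃ v, normalArcs k v X).Finite := (Set.finite_iUnion hX.finite).image _
  have hd : (im '' ⋃ v, normalArcs k v X).PairwiseDisjoint id := by
    rintro _ ⟨A, hA, rfl⟩ _ ⟨B, hB, rfl⟩ hAB
    obtain ⟨v, hA⟩ := Set.mem_iUnion.1 hA
    obtain ⟨v', hB⟩ := Set.mem_iUnion.1 hB
    have := hX.disjoint v v' A B hA hB (fun h => hAB (by rw [h]))
    exact (Set.disjoint_image_iff hfi).2 (this.preimage _)
  have hn : ∀ A ∈ im '' ⋃ v, normalArcs k v X, ∃ v, IsNormalArc k v A := by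
    rintro _ ⟨A, hA, rfl⟩
    obtain ⟨v, hA⟩ := Set.mem_iUnion.1 hA
    exact ⟨v, him v A hA⟩
  have hU : Set.range f ∩ facet k = ⋃₀ (im '' ⋃ v, normalArcs k v X) := by
    ext y
    constructor
    · rintro ⟨⟨x, rfl⟩, hy⟩
      have hxk : x.1 k = 0 := by
        rw [← mem_zeros, ← hfz]; exact hy
      obtain ⟨v, A, hA, hxA⟩ := hX.cover x.1 x.2 hxk
      exact ⟨im A, ⟨A, Set.mem_iUnion.2 ⟨v, hA⟩, rfl⟩, ⟨x, hxA, rfl⟩⟩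
    · rintro ⟨_, ⟨A, hA, rfl⟩, x, hx, rfl⟩
      obtain ⟨v, hA⟩ := Set.mem_iUnion.1 hA
      exact ⟨⟨x, rfl⟩, (him v A hA).apply_eq_zero ⟨x, hx, rfl⟩⟩
  refine ⟨isArcSystem_of_sUnion hF hd hn hU, fun v => ?_⟩
  rw [normalArcs_eq_of_sUnion hF hd hn hU v]
  have heq : {A ∈ im '' ⋃ v, normalArcs k v X | IsNormalArc k v A} = im '' normalArcs k v X := by
    ext B
    constructor
    · rintro ⟨⟨A, hA, rfl⟩, hB⟩
      obtain ⟨v', hA⟩ := Set.mem_iUnion.1 hA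
      obtain rfl := hB.corner_unique (him v' A hA)
      exact ⟨A, hA, rfl⟩
    · rintro ⟨A, hA, rfl⟩
      exact ⟨⟨A, Set.mem_iUnion.2 ⟨v, hA⟩, rfl⟩, him v A hA⟩
  rw [heq]
  refine Set.InjOn.ncard_image fun A hA B hB hAB => ?_
  have := Set.image_injective.2 hfi hAB
  have h2 := congrArg (Set.image Subtype.val) this
  rwa [Subtype.image_preimage_coe, Subtype.image_preimage_coe,
    Set.inter_eq_right.2 hA.2, Set.inter_eq_right.2 hB.2] at h2

end

end NormalSurf

namespace NormalSurf

/-! ### Ends of normal arcs on the edges -/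

/-- The points of `X` in the interior of the edge along which the facets `k` and `c` meet. -/
def edgePts (k c : Fin 4) (X : Set Tetra) : Set Tetra := {x | x ∈ X ∧ zeros x = {k, c}}

theorem edgePts_comm (k c : Fin 4) (X : Set Tetra) : edgePts k c X = edgePts c k X := by
  simp only [edgePts, Set.pair_comm]

/-- The end of the normal arc `A` of the facet `k` on the facet `c`. -/
def arcEnd (k c : Fin 4) (A : Set Tetra) : Tetra :=
  Classical.epsilon fun x => x ∈ A ∧ zeros x = {k, c}

theorem IsNormalArc.arcEnd_spec {k v c : Fin 4} {A : Set Tetra} (hA : IsNormalArc k v A)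
    (hc : c ≠ k) (hcv : c ≠ v) : arcEnd k c A ∈ A ∧ zeros (arcEnd k c A) = {k, c} :=
  Classical.epsilon_spec (p := fun x => x ∈ A ∧ zeros x = {k, c})
    (hA.existsUnique_end hc hcv).exists

theorem IsNormalArc.eq_arcEnd {k v c : Fin 4} {A : Set Tetra} (hA : IsNormalArc k v A)
    (hc : c ≠ k) (hcv : c ≠ v) {x : Tetra} (hx : x ∈ A) (hz : zeros x = {k, c}) :
    x = arcEnd k c A :=
  (hA.existsUnique_end hc hcv).unique ⟨hx, hz⟩ (hA.arcEnd_spec hc hcv)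

theorem nodup_ne {k v u w : Fin 4} (h : [k, v, u, w].Nodup) :
    v ≠ k ∧ u ≠ k ∧ w ≠ k ∧ u ≠ v ∧ w ≠ v ∧ w ≠ u := by
  simp only [List.nodup_cons, List.mem_cons, not_or, List.not_mem_nil] at h; grind

/-- A point on an edge is determined by one coordinate. -/
theorem edge_ext {k v u w : Fin 4} (h : [k, v, u, w].Nodup) {p q : Tetra}
    (hp : zeros p = {k, w}) (hq : zeros q = {k, w}) (hu : p u = q u) : p = q := by
  have a1 : p k = 0 := mem_zeros.1 (by simp [hp])
  have a2 : p w = 0 := mem_zeros.1 (by simp [hp])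
  have b1 : q k = 0 := mem_zeros.1 (by simp [hq])
  have b2 : q w = 0 := mem_zeros.1 (by simp [hq])
  exact tetra_ext h (a1.trans b1.symm) hu (a2.trans b2.symm)

theorem edge_add {k v u w : Fin 4} (h : [k, v, u, w].Nodup) {p : Tetra}
    (hp : zeros p = {k, w}) : p v + p u = 1 := by
  have a1 : p k = 0 := mem_zeros.1 (by simp [hp])
  have a2 : p w = 0 := mem_zeros.1 (by simp [hp])
  have := tetra_sum h p
  linarith

namespace IsArcSystem

variable {k v u w : Fin 4} {X Y : Set Tetra}

theorem eq_of_mem (hX : IsArcSystem k X) {v' : Fin 4} {A B : Set Tetra}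
    (hA : A ∈ normalArcs k v X) (hB : B ∈ normalArcs k v' X) {x : Tetra} (hxA : x ∈ A)
    (hxB : x ∈ B) : A = B := by
  by_contra h
  exact Set.disjoint_left.1 (hX.disjoint v v' A B hA hB h) hxA hxB

theorem injOn_arcEnd (hX : IsArcSystem k X) (hw : w ≠ k) (hwv : w ≠ v) :
    Set.InjOn (arcEnd k w) (normalArcs k v X) := fun _ hA _ hB hAB =>
  hX.eq_of_mem hA hB (hA.1.arcEnd_spec hw hwv).1 (hAB ▸ (hB.1.arcEnd_spec hw hwv).1)

/-- An arc around `w` avoids the edge from `v` to `u`. Hence every point there is an end of an arc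
around `v` or `u`. -/
theorem edgePts_eq (hX : IsArcSystem k X) (h : [k, v, u, w].Nodup) :
    edgePts k w X = arcEnd k w '' normalArcs k v X ∪ arcEnd k w '' normalArcs k u X := by
  obtain ⟨hvk, huk, hwk, huv, hwv, hwu⟩ := nodup_ne h
  ext x
  constructor
  · rintro ⟨hx, hz⟩
    obtain ⟨v', A, hA, hxA⟩ := hX.cover x hx (mem_zeros.1 (by simp [hz]))
    have hv'k := hA.1.ne
    have hv'w : w ≠ v' := fun e => hA.1.zeros_ne hxA (e ▸ hz)
    have hx' := hA.1.eq_arcEnd hwk hv'w hxA hz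
    rcases eq_of_nodup h v' with rfl | rfl | rfl | rfl
    · exact absurd rfl hv'k
    · exact .inl ⟨A, hA, hx'.symm⟩
    · exact .inr ⟨A, hA, hx'.symm⟩
    · exact absurd rfl hv'w
  · rintro (⟨A, hA, rfl⟩ | ⟨A, hA, rfl⟩)
    · exact ⟨hA.2 (hA.1.arcEnd_spec hwk hwv).1, (hA.1.arcEnd_spec hwk hwv).2⟩
    · exact ⟨hA.2 (hA.1.arcEnd_spec hwk hwu).1, (hA.1.arcEnd_spec hwk hwu).2⟩

theorem disjoint_image_arcEnd (hX : IsArcSystem k X) (h : [k, v, u, w].Nodup) :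
    Disjoint (arcEnd k w '' normalArcs k v X) (arcEnd k w '' normalArcs k u X) := by
  obtain ⟨hvk, huk, hwk, huv, hwv, hwu⟩ := nodup_ne h
  rw [Set.disjoint_left]
  rintro _ ⟨A, hA, rfl⟩ ⟨B, hB, hAB⟩
  have hA' := hA.1.arcEnd_spec hwk hwv
  have hB' := hB.1.arcEnd_spec hwk hwu
  have : A = B := hX.eq_of_mem hA hB hA'.1 (hAB ▸ hB'.1)
  subst this
  exact huv (hB.1.corner_unique hA.1)

theorem finite_edgePts (hX : IsArcSystem k X) (h : [k, v, u, w].Nodup) :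
    (edgePts k w X).Finite := by
  rw [hX.edgePts_eq h]
  exact ((hX.finite v).image _).union ((hX.finite u).image _)

theorem ncard_edgePts (hX : IsArcSystem k X) (h : [k, v, u, w].Nodup) :
    (edgePts k w X).ncard = (normalArcs k v X).ncard + (normalArcs k u X).ncard := by
  obtain ⟨hvk, huk, hwk, huv, hwv, hwu⟩ := nodup_ne h
  rw [hX.edgePts_eq h, Set.ncard_union_eq (hX.disjoint_image_arcEnd h)
    ((hX.finite v).image _) ((hX.finite u).image _),
    (hX.injOn_arcEnd hwk hwv).ncard_image, (hX.injOn_arcEnd hwk hwu).ncard_image]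

theorem finsum_edgePts (hX : IsArcSystem k X) (h : [k, v, u, w].Nodup) (f : Tetra → ℤ) :
    ∑ᶠ p ∈ edgePts k w X, f p =
      ∑ A ∈ (hX.finite v).toFinset, f (arcEnd k w A) +
        ∑ A ∈ (hX.finite u).toFinset, f (arcEnd k w A) := by
  obtain ⟨hvk, huk, hwk, huv, hwv, hwu⟩ := nodup_ne h
  rw [hX.edgePts_eq h, finsum_mem_union (hX.disjoint_image_arcEnd h)
    ((hX.finite v).image _) ((hX.finite u).image _),
    finsum_mem_image (hX.injOn_arcEnd hwk hwv), finsum_mem_image (hX.injOn_arcEnd hwk hwu),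
    finsum_mem_eq_finite_toFinset_sum _ (hX.finite v),
    finsum_mem_eq_finite_toFinset_sum _ (hX.finite u)]

end IsArcSystem

/-! ### Signed crossing numbers -/

/-- `1` if the `u`-coordinate of `p` is smaller than that of `q` and `-1` otherwise. -/
def orderSign (u : Fin 4) (p q : Tetra) : ℤ := open Classical in if p u < q u then 1 else -1

/-- The total order sign of the points of `X` and `Y` on an edge. -/
def edgeSign (k w u : Fin 4) (X Y : Set Tetra) : ℤ :=
  ∑ᶠ p ∈ edgePts k w X, ∑ᶠ q ∈ edgePts k w Y, orderSign u p q

theorem edgeSign_comm (k w u : Fin 4) (X Y : Set Tetra) :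
    edgeSign k w u X Y = edgeSign w k u X Y := by
  simp only [edgeSign, edgePts_comm k w]

/-- The total order sign of the ends of the normal arcs of `X` and `Y` around the corner `v`, on
the edge from `v` to `u`. -/
def cornerSign (k v u w : Fin 4) (X Y : Set Tetra) : ℤ :=
  ∑ᶠ A ∈ normalArcs k v X, ∑ᶠ B ∈ normalArcs k v Y, orderSign u (arcEnd k w A) (arcEnd k w B)

section

variable {k v u w : Fin 4} {X Y : Set Tetra}

/-- Disjoint arcs around one corner are nested, so the order of their ends is the same on both
edges. -/
theorem cornerSign_comm (hXY : Disjoint X Y) (h : [k, v, u, w].Nodup) :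
    cornerSign k v u w X Y = cornerSign k v w u X Y := by
  obtain ⟨hvk, huk, hwk, huv, hwv, hwu⟩ := nodup_ne h
  refine finsum_mem_congr rfl fun A hA => finsum_mem_congr rfl fun B hB => ?_
  have hAB : Disjoint A B := hXY.mono hA.2 hB.2
  have a := hA.1.arcEnd_spec hwk hwv
  have a' := hA.1.arcEnd_spec huk huv
  have b := hB.1.arcEnd_spec hwk hwv
  have b' := hB.1.arcEnd_spec huk huv
  have h1 := hB.1.lt_of_disjoint (nodup_swap h) hA.1 hAB.symm b'.1 a'.1 b.1 a.1 b'.2 a'.2 b.2 a.2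
  have h2 := hB.1.lt_of_disjoint h hA.1 hAB.symm b.1 a.1 b'.1 a'.1 b.2 a.2 b'.2 a'.2
  simp only [orderSign]
  congr 1
  exact propext ⟨h2, h1⟩

theorem orderSign_swap (h : [k, v, u, w].Nodup) {p q : Tetra} (hp : zeros p = {k, w})
    (hq : zeros q = {k, w}) (hpq : p ≠ q) : orderSign u p q = -orderSign v p q := by
  have h1 := edge_add h hp
  have h2 := edge_add h hq
  have h3 : p u ≠ q u := fun e => hpq (edge_ext h hp hq e)
  simp only [orderSign]
  split_ifs with a b b
  · exfalso; linarith
  · simp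
  · simp
  · exact absurd (le_antisymm (by linarith) (by linarith)) h3

theorem sum_sum_eq_of_forall {α β : Type*} {s : Finset α} {t : Finset β} {f : α → β → ℤ} (c : ℤ)
    (h : ∀ a ∈ s, ∀ b ∈ t, f a b = c) : ∑ a ∈ s, ∑ b ∈ t, f a b = s.card * t.card * c := by
  rw [Finset.sum_congr rfl fun a ha => Finset.sum_congr rfl fun b hb => h a ha b hb]
  simp [mul_assoc]

/-- The pairs of points are split by the corners of their arcs. For different corners the arc around
`v` ends nearer to `v`, so the sign is forced and products of arc numbers appear. Pairs at `u` are
reversed because the corner sign there orders the edge from `u`. -/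
theorem edgeSign_eq (hX : IsArcSystem k X) (hY : IsArcSystem k Y) (hXY : Disjoint X Y)
    (h : [k, v, u, w].Nodup) :
    edgeSign k w u X Y =
      (normalArcs k v X).ncard * (normalArcs k u Y).ncard
        - (normalArcs k u X).ncard * (normalArcs k v Y).ncard
        + cornerSign k v u w X Y - cornerSign k u v w X Y := by
  obtain ⟨hvk, huk, hwk, huv, hwv, hwu⟩ := nodup_ne h
  have hd : ∀ {v v' A B}, A ∈ normalArcs k v X → B ∈ normalArcs k v' Y → Disjoint A B :=
    fun hA hB => hXY.mono hA.2 hB.2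
  have hfin : ∀ x : Fin 4, ∀ f : Set Tetra → Set Tetra → ℤ,
      ∑ᶠ A ∈ normalArcs k x X, ∑ᶠ B ∈ normalArcs k x Y, f A B =
        ∑ A ∈ (hX.finite x).toFinset, ∑ B ∈ (hY.finite x).toFinset, f A B := fun x f => by
    rw [finsum_mem_eq_finite_toFinset_sum _ (hX.finite x)]
    exact Finset.sum_congr rfl fun A _ => finsum_mem_eq_finite_toFinset_sum _ (hY.finite x)
  have e1 : ∑ A ∈ (hX.finite v).toFinset, ∑ B ∈ (hY.finite u).toFinset,
      orderSign u (arcEnd k w A) (arcEnd k w B) =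
        (normalArcs k v X).ncard * (normalArcs k u Y).ncard := by
    rw [Set.ncard_eq_toFinset_card _ (hX.finite v), Set.ncard_eq_toFinset_card _ (hY.finite u),
      sum_sum_eq_of_forall 1, mul_one]
    intro A hA B hB
    rw [Set.Finite.mem_toFinset] at hA hB
    have a := hA.1.arcEnd_spec hwk hwv
    have b := hB.1.arcEnd_spec hwk hwu
    exact if_pos (hA.1.lt_of_disjoint' h hB.1 (hd hA hB) a.1 b.1 a.2 b.2)
  have e2 : ∑ A ∈ (hX.finite u).toFinset, ∑ B ∈ (hY.finite v).toFinset,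
      orderSign u (arcEnd k w A) (arcEnd k w B) =
        -((normalArcs k u X).ncard * (normalArcs k v Y).ncard) := by
    rw [Set.ncard_eq_toFinset_card _ (hX.finite u), Set.ncard_eq_toFinset_card _ (hY.finite v),
      sum_sum_eq_of_forall (-1), mul_neg_one]
    intro A hA B hB
    rw [Set.Finite.mem_toFinset] at hA hB
    have a := hA.1.arcEnd_spec hwk hwu
    have b := hB.1.arcEnd_spec hwk hwv
    exact if_neg (not_lt.2 (hB.1.lt_of_disjoint' h hA.1 (hd hA hB).symm b.1 a.1 b.2 a.2).le)
  have e3 : ∑ A ∈ (hX.finite u).toFinset, ∑ B ∈ (hY.finite u).toFinset,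
      orderSign u (arcEnd k w A) (arcEnd k w B) = -cornerSign k u v w X Y := by
    rw [cornerSign, hfin, ← Finset.sum_neg_distrib]
    refine Finset.sum_congr rfl fun A hA => ?_
    rw [← Finset.sum_neg_distrib]
    refine Finset.sum_congr rfl fun B hB => ?_
    rw [Set.Finite.mem_toFinset] at hA hB
    have a := hA.1.arcEnd_spec hwk hwu
    have b := hB.1.arcEnd_spec hwk hwu
    refine orderSign_swap h a.2 b.2 fun e => ?_
    exact Set.disjoint_left.1 (hd hA hB) a.1 (e ▸ b.1)
  have e4 : ∀ p, ∑ᶠ q ∈ edgePts k w Y, orderSign u p q = _ := fun p =>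
    hY.finsum_edgePts h (orderSign u p)
  rw [edgeSign, hX.finsum_edgePts h]
  simp only [e4, Finset.sum_add_distrib]
  have e5 : cornerSign k v u w X Y = _ := hfin v _
  rw [e1, e2, e3, e5]
  ring

end

theorem perm_nodup (σ : Equiv.Perm (Fin 4)) : [σ 0, σ 1, σ 2, σ 3].Nodup := by
  have : [σ 0, σ 1, σ 2, σ 3] = [0, 1, 2, 3].map σ := rfl
  rw [this]
  exact List.Nodup.map σ.injective (by decide)

/-- Reindexing by the transposition changes the sign of the sum. -/
theorem sum_sign_mul_eq_zero (f : Equiv.Perm (Fin 4) → ℤ) (i j : Fin 4) (hij : i ≠ j)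
    (h : ∀ σ, f (σ * Equiv.swap i j) = f σ) :
    ∑ σ : Equiv.Perm (Fin 4), (Equiv.Perm.sign σ : ℤ) * f σ = 0 := by
  have := Equiv.sum_comp (Equiv.mulRight (Equiv.swap i j))
    fun σ : Equiv.Perm (Fin 4) => (Equiv.Perm.sign σ : ℤ) * f σ
  simp only [Equiv.coe_mulRight, Equiv.Perm.sign_mul, Equiv.Perm.sign_swap hij, h,
    Units.val_neg, mul_neg, mul_one, neg_mul, Finset.sum_neg_distrib] at this
  linarith

/-- The alternating form of the normal coordinates of two disjoint systems of normal arcs in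
the boundary of a tetrahedron vanishes. -/
theorem sum_sign_ncard_mul_ncard {X Y : Set Tetra} (hX : ∀ k, IsArcSystem k X)
    (hY : ∀ k, IsArcSystem k Y) (hXY : Disjoint X Y) :
    ∑ σ : Equiv.Perm (Fin 4), (Equiv.Perm.sign σ : ℤ) *
      ((normalArcs (σ 0) (σ 1) X).ncard * (normalArcs (σ 0) (σ 2) Y).ncard) = 0 := by
  -- Edge signs are invariant under exchanging the two facets at the edge, and corner signs under
  -- exchanging the two edges at the corner. Thus both disappear from the alternating sum of
  -- `edgeSign_eq`.
  have h0 := sum_sign_mul_eq_zero (fun σ => edgeSign (σ 0) (σ 3) (σ 2) X Y) 0 3 (by decide)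
    (fun σ => by
      simp only [Equiv.Perm.coe_mul, Function.comp_apply, Equiv.swap_apply_left,
        Equiv.swap_apply_right, Equiv.swap_apply_of_ne_of_ne (show (2 : Fin 4) ≠ 0 by decide)
        (show (2 : Fin 4) ≠ 3 by decide)]
      exact edgeSign_comm _ _ _ _ _)
  have h1 := sum_sign_mul_eq_zero (fun σ => cornerSign (σ 0) (σ 1) (σ 2) (σ 3) X Y) 2 3
    (by decide) (fun σ => by
      simp only [Equiv.Perm.coe_mul, Function.comp_apply, Equiv.swap_apply_left,
        Equiv.swap_apply_right, Equiv.swap_apply_of_ne_of_ne (show (0 : Fin 4) ≠ 2 by decide)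
        (show (0 : Fin 4) ≠ 3 by decide), Equiv.swap_apply_of_ne_of_ne
        (show (1 : Fin 4) ≠ 2 by decide) (show (1 : Fin 4) ≠ 3 by decide)]
      exact (cornerSign_comm hXY (perm_nodup σ)).symm)
  have h2 := sum_sign_mul_eq_zero (fun σ => cornerSign (σ 0) (σ 2) (σ 1) (σ 3) X Y) 1 3
    (by decide) (fun σ => by
      simp only [Equiv.Perm.coe_mul, Function.comp_apply, Equiv.swap_apply_left,
        Equiv.swap_apply_right, Equiv.swap_apply_of_ne_of_ne (show (0 : Fin 4) ≠ 1 by decide)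
        (show (0 : Fin 4) ≠ 3 by decide), Equiv.swap_apply_of_ne_of_ne
        (show (2 : Fin 4) ≠ 1 by decide) (show (2 : Fin 4) ≠ 3 by decide)]
      exact (cornerSign_comm hXY (nodup_swap' (perm_nodup σ))).symm)
  -- Exchanging positions 1 and 2 identifies the two product terms up to sign, so twice the required
  -- sum remains.
  have h3 : ∑ σ : Equiv.Perm (Fin 4), (Equiv.Perm.sign σ : ℤ) *
      ((normalArcs (σ 0) (σ 2) X).ncard * (normalArcs (σ 0) (σ 1) Y).ncard) =
      -∑ σ : Equiv.Perm (Fin 4), (Equiv.Perm.sign σ : ℤ) *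
      ((normalArcs (σ 0) (σ 1) X).ncard * (normalArcs (σ 0) (σ 2) Y).ncard) := by
    rw [← Equiv.sum_comp (Equiv.mulRight (Equiv.swap 1 2)), ← Finset.sum_neg_distrib]
    refine Finset.sum_congr rfl fun σ _ => ?_
    simp [Equiv.Perm.sign_mul, Equiv.Perm.sign_swap (show (1 : Fin 4) ≠ 2 by decide),
      Equiv.swap_apply_of_ne_of_ne (show (0 : Fin 4) ≠ 1 by decide) (show (0 : Fin 4) ≠ 2 by decide)]
  rw [Finset.sum_congr rfl fun σ _ => by
    rw [edgeSign_eq (hX (σ 0)) (hY (σ 0)) hXY (perm_nodup σ)]] at h0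
  simp only [mul_sub, mul_add, Finset.sum_add_distrib, Finset.sum_sub_distrib] at h0
  linarith

end NormalSurf

namespace NormalSurf

/-! ### Affine identifications of faces -/

section Relabel

variable (π : Equiv.Perm (Fin 4))

theorem map_apply_perm (x : Tetra) (i : Fin 4) : stdSimplex.map π x (π i) = x i := by
  rw [stdSimplex.map_coe, FunOnFinite.linearMap_apply_apply]
  rw [Finset.sum_eq_single i]
  · intro j hj hji
    exact absurd (π.injective (Finset.mem_filter.1 hj).2) hji
  · simp

theorem map_inv_map (x : Tetra) : stdSimplex.map ⇑π⁻¹ (stdSimplex.map π x) = x := by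
  rw [stdSimplex.map_comp_apply]
  have : (⇑π⁻¹ ∘ ⇑π : Fin 4 → Fin 4) = id := by ext; simp
  rw [this, stdSimplex.map_id_apply]

theorem map_map_inv (x : Tetra) : stdSimplex.map π (stdSimplex.map ⇑π⁻¹ x) = x := by
  simpa using map_inv_map π⁻¹ x

theorem map_perm_injective :
    Function.Injective (stdSimplex.map π : Tetra → Tetra) :=
  Function.LeftInverse.injective (map_inv_map π)

theorem zeros_map (x : Tetra) : zeros (stdSimplex.map π x) = π '' zeros x := by
  ext i
  rw [mem_zeros]
  constructor
  · intro h
    refine ⟨π⁻¹ i, ?_, by simp⟩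
    rw [mem_zeros, ← map_apply_perm π]
    simpa using h
  · rintro ⟨j, hj, rfl⟩
    rw [map_apply_perm]; exact hj

variable {π}

theorem IsNormalArc.map {k v : Fin 4} {A : Set Tetra} (hA : IsNormalArc k v A) :
    IsNormalArc (π k) (π v) (stdSimplex.map π '' A) := by
  obtain ⟨u, w, h, γ, hc, hi, rfl, h0, h1, hs⟩ := hA
  refine ⟨π u, π w, List.Nodup.map π.injective h, stdSimplex.map π ∘ γ,
    (stdSimplex.continuous_map _).comp hc, (map_perm_injective π).comp hi, Set.range_comp _ _,
    ?_, ?_, fun s h0s hs1 => ?_⟩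
  · simp [zeros_map, h0, Set.image_pair]
  · simp [zeros_map, h1, Set.image_pair]
  · simp [zeros_map, hs s h0s hs1]

theorem IsNormalArc.exists_zeros_eq_singleton {k v : Fin 4} {A : Set Tetra}
    (hA : IsNormalArc k v A) : ∃ x ∈ A, zeros x = {k} := by
  obtain ⟨u, w, h, γ, hc, hi, rfl, h0, h1, hs⟩ := hA
  refine ⟨γ ⟨1 / 2, by norm_num, by norm_num⟩, ⟨_, rfl⟩, hs _ ?_ ?_⟩
  · rw [← Subtype.coe_lt_coe]; norm_num
  · rw [← Subtype.coe_lt_coe]; norm_num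

end Relabel

namespace OrientedTriangulation

variable (K : OrientedTriangulation)

/-! ### Normal coordinates of surfaces -/

/-- The number of normal arcs of `S` around the corner `v` of the facet `k` of the
tetrahedron `t`. -/
def arcCount (S : Set K.Space) (t : K.Tet) (k v : Fin 4) : ℕ :=
  (normalArcs k v (K.trace S t)).ncard

/-- Every trace of `S` on the boundary of a tetrahedron is a collection of normal loops. -/
def HasNormalTraces (S : Set K.Space) : Prop := ∀ t, IsNormalLoopCollection (K.trace S t)

variable {K}

theorem HasNormalTraces.isArcSystem {S : Set K.Space} (hS : K.HasNormalTraces S) (t : K.Tet)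
    (k : Fin 4) : IsArcSystem k (K.trace S t) := (hS t).isArcSystem k

theorem char_glue {t t₁ : K.Tet} {k : Fin 4} {π : Equiv.Perm (Fin 4)}
    (h : K.glue t k = some (t₁, π)) {x : Tetra} (hx : x k = 0) :
    K.char t₁ (stdSimplex.map π x) = K.char t x :=
  (Quot.sound (Rel.mk t k t₁ π x h hx)).symm

theorem arcCount_le_of_glue {S : Set K.Space} (hS : K.HasNormalTraces S) {t t₁ : K.Tet}
    {k : Fin 4} {π : Equiv.Perm (Fin 4)} (h : K.glue t k = some (t₁, π)) (v : Fin 4) :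
    K.arcCount S t k v ≤ K.arcCount S t₁ (π k) (π v) := by
  rw [arcCount, ← Set.ncard_image_of_injective _ (Set.image_injective.2 (map_perm_injective π))]
  refine Set.ncard_le_ncard ?_ ((hS.isArcSystem t₁ (π k)).finite _)
  rintro _ ⟨A, ⟨hA, hAS⟩, rfl⟩
  refine ⟨hA.map, ?_⟩
  rintro _ ⟨x, hx, rfl⟩
  have hxk := hA.apply_eq_zero hx
  refine ⟨⟨π k, ?_⟩, ?_⟩
  · rw [map_apply_perm]; exact hxk
  · rw [char_glue h hxk]; exact (hAS hx).2

/-- The gluing and its inverse both carry arcs injectively to arcs, which gives the two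
inequalities. -/
theorem arcCount_glue {S : Set K.Space} (hS : K.HasNormalTraces S) {t t₁ : K.Tet}
    {k : Fin 4} {π : Equiv.Perm (Fin 4)} (h : K.glue t k = some (t₁, π)) (v : Fin 4) :
    K.arcCount S t₁ (π k) (π v) = K.arcCount S t k v := by
  refine le_antisymm ?_ (arcCount_le_of_glue hS h v)
  simpa using arcCount_le_of_glue hS (K.glue_symm _ _ _ _ h) (π v)

/-- The alternating form of the normal coordinates on the facet `k` of `t`. -/
def facetForm (F G : Set K.Space) (t : K.Tet) (k : Fin 4) : ℤ :=
  ∑ σ : Equiv.Perm (Fin 4), if σ 0 = k then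
    (Equiv.Perm.sign σ : ℤ) * (K.arcCount F t k (σ 1) * K.arcCount G t k (σ 2)) else 0

/-- Normal isotopies preserve the arc numbers, so the identity for disjoint systems applies. -/
theorem sum_facetForm {F G : Set K.Space} (hF : K.HasNormalTraces F) (hG : K.HasNormalTraces G)
    (hFG : K.Compatible F G) (t : K.Tet) : ∑ k, facetForm F G t k = 0 := by
  obtain ⟨X, Y, hX, hY, hXY⟩ := hFG t
  have hX' := fun k => hX.isArcSystem (hF.isArcSystem t k)
  have hY' := fun k => hY.isArcSystem (hG.isArcSystem t k)
  have := sum_sign_ncard_mul_ncard (fun k => (hX' k).1) (fun k => (hY' k).1) hXY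
  simp only [fun k => (hX' k).2, fun k => (hY' k).2] at this
  simp only [facetForm]
  rw [Finset.sum_comm]
  refine Eq.trans (Finset.sum_congr rfl fun σ _ => ?_) this
  rw [Finset.sum_ite_eq]
  simp [arcCount]

theorem facetForm_glue {F G : Set K.Space} (hF : K.HasNormalTraces F) (hG : K.HasNormalTraces G)
    {t t₁ : K.Tet} {k : Fin 4} {π : Equiv.Perm (Fin 4)} (h : K.glue t k = some (t₁, π)) :
    facetForm F G t₁ (π k) = Equiv.Perm.sign π * facetForm F G t k := by
  rw [facetForm, facetForm, ← Equiv.sum_comp (Equiv.mulLeft π), Finset.mul_sum]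
  refine Finset.sum_congr rfl fun σ _ => ?_
  simp only [Equiv.coe_mulLeft, Equiv.Perm.coe_mul, Function.comp_apply, π.injective.eq_iff,
    Equiv.Perm.sign_mul, Units.val_mul, arcCount_glue hF h, arcCount_glue hG h, mul_ite, mul_zero,
    mul_assoc]

instance : Finite K.Tet := K.finite_tet

/-- The forms on the free facets add up to zero. -/
theorem sum_free_facetForm [Fintype K.Tet] {F G : Set K.Space} (hF : K.HasNormalTraces F)
    (hG : K.HasNormalTraces G) (hFG : K.Compatible F G) :
    ∑ p : K.Tet × Fin 4, (if K.glue p.1 p.2 = none then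
      (K.orient p.1 : ℤ) * facetForm F G p.1 p.2 else 0) = 0 := by
  have h1 : ∑ p : K.Tet × Fin 4, (K.orient p.1 : ℤ) * facetForm F G p.1 p.2 = 0 := by
    rw [Fintype.sum_prod_type]
    refine Finset.sum_eq_zero fun t _ => ?_
    simp only
    rw [← Finset.mul_sum, sum_facetForm hF hG hFG, mul_zero]
  have h2 : ∑ p : K.Tet × Fin 4, (if K.glue p.1 p.2 = none then 0 else
      (K.orient p.1 : ℤ) * facetForm F G p.1 p.2) = 0 := by
    -- Each glued facet is paired with its partner. The sign of `π` from `facetForm_glue` meets the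
    -- negated one in `orient_glue`, so the pair cancels. Free facets are fixed by the involution
    -- but contribute 0.
    let ι : K.Tet × Fin 4 → K.Tet × Fin 4 := fun p =>
      (K.glue p.1 p.2).elim p fun q => (q.1, q.2 p.2)
    refine Finset.sum_involution (fun p _ => ι p) ?_ ?_ (fun _ _ => Finset.mem_univ _) ?_
    · rintro ⟨t, k⟩ -
      rcases hg : K.glue t k with _ | ⟨t₁, π⟩
      · simp [ι, hg]
      · have := K.glue_symm _ _ _ _ hg
        simp only [ι, hg, Option.elim, this, reduceCtorEq, if_false, facetForm_glue hF hG hg,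
          K.orient_glue _ _ _ _ hg]
        have hs : (Equiv.Perm.sign π : ℤ) * Equiv.Perm.sign π = 1 := by
          rcases Int.units_eq_one_or (Equiv.Perm.sign π) with e | e <;> simp [e]
        push_cast
        linear_combination (-(K.orient t : ℤ) * facetForm F G t k) * hs
    · rintro ⟨t, k⟩ - hne
      rcases hg : K.glue t k with _ | ⟨t₁, π⟩
      · simp [hg] at hne
      · simpa [ι, hg] using K.glue_ne _ _ _ _ hg
    · rintro ⟨t, k⟩ -
      rcases hg : K.glue t k with _ | ⟨t₁, π⟩
      · simp [ι, hg]
      · have := K.glue_symm _ _ _ _ hg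
        simp [ι, hg, this]
  refine Eq.trans ?_ (sub_eq_zero.2 (h1.trans h2.symm))
  rw [← Finset.sum_sub_distrib]
  refine Finset.sum_congr rfl fun p _ => ?_
  split_ifs <;> simp

/-- A point in the interior of a free facet is not identified with any other point. -/
theorem eq_of_char_eq {t t' : K.Tet} {k : Fin 4} (h : K.glue t k = none) {x x' : Tetra}
    (hx : zeros x = {k}) (hxx : K.char t' x' = K.char t x) :
    (⟨t', x'⟩ : Σ _ : K.Tet, Tetra) = ⟨t, x⟩ := by
  -- The only facet containing `x` is free, so no elementary identification involves this point, and
  -- being equal to it descends to the quotient.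
  let P : K.Space → Prop := Quot.lift (fun q => q = ⟨t, x⟩) (by
    rintro _ _ ⟨s, l, s₁, π, y, hg, hy⟩
    refine propext ⟨fun e => ?_, fun e => ?_⟩
    · obtain ⟨rfl, e⟩ := Sigma.mk.inj_iff.1 e
      rename_i e'
      obtain rfl := eq_of_heq e'
      have : l ∈ zeros y := hy
      rw [hx] at this
      obtain rfl : l = k := this
      rw [h] at hg; cases hg
    · obtain ⟨rfl, e⟩ := Sigma.mk.inj_iff.1 e
      rename_i e'
      obtain rfl := eq_of_heq e'
      have : π l ∈ zeros (stdSimplex.map π y) := by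
        rw [mem_zeros, map_apply_perm]; exact hy
      rw [hx] at this
      have hg' := K.glue_symm _ _ _ _ hg
      rw [show π l = k from this, h] at hg'
      cases hg')
  have h1 : P (K.char t x) := rfl
  rw [← hxx] at h1
  exact h1

/-- The normal coordinates vanish on the free facets that are not contained in a torus which
contains all the boundary curves. -/
theorem arcCount_eq_zero_of_free {S : Set K.Space} {T₁ T₂ : K.BoundaryTorus}
    (hS : S ∩ K.boundary ⊆ T₁.carrier ∪ T₂.carrier) {t : K.Tet} {k : Fin 4}
    (h : K.glue t k = none) (h₁ : ∀ j, (t, k) ≠ (T₁.tet j, T₁.lab j 0))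
    (h₂ : ∀ j, (t, k) ≠ (T₂.tet j, T₂.lab j 0)) (v : Fin 4) : K.arcCount S t k v = 0 := by
  rw [arcCount]
  suffices normalArcs k v (K.trace S t) = ∅ by rw [this, Set.ncard_empty]
  refine Set.eq_empty_of_forall_notMem fun A hA => ?_
  obtain ⟨x, hxA, hx⟩ := hA.1.exists_zeros_eq_singleton
  have key : ∀ T : K.BoundaryTorus, (∀ j, (t, k) ≠ (T.tet j, T.lab j 0)) →
      K.char t x ∉ T.carrier := fun T hT hmem => by
    obtain ⟨j, x', hx', he⟩ := Set.mem_iUnion.1 hmem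
    obtain ⟨e1, e2⟩ := Sigma.mk.inj_iff.1 (eq_of_char_eq h hx he)
    obtain rfl := eq_of_heq e2
    have : T.lab j 0 ∈ zeros x' := hx'
    rw [hx] at this
    exact hT j (by rw [e1, show T.lab j 0 = k from this])
  rcases hS ⟨(hA.2 hxA).2, t, k, x, h, hA.1.apply_eq_zero hxA, rfl⟩ with hm | hm
  · exact key T₁ h₁ hm
  · exact key T₂ h₂ hm

/-! ### Normal coordinates on a boundary torus -/

/-- A permutation fixing 0 is determined by its values at 1 and 2; the table of signs is checked by
evaluation. -/
theorem sum_perm_fix_zero (f : Fin 4 → Fin 4 → ℤ) :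
    ∑ τ : Equiv.Perm (Fin 4), (if τ 0 = 0 then (Equiv.Perm.sign τ : ℤ) * f (τ 1) (τ 2) else 0) =
      f 1 2 - f 2 1 + f 2 3 - f 3 2 + f 3 1 - f 1 3 := by
  have h : ∀ a b : Fin 4, ∑ τ : Equiv.Perm (Fin 4),
      (if τ 0 = 0 ∧ τ 1 = a ∧ τ 2 = b then (Equiv.Perm.sign τ : ℤ) else 0) =
      ![![0, 0, 0, 0], ![0, 0, 1, -1], ![0, -1, 0, 1], ![0, 1, -1, 0]] a b := by decide +kernel
  calc _ = ∑ a, ∑ b, (∑ τ : Equiv.Perm (Fin 4),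
      (if τ 0 = 0 ∧ τ 1 = a ∧ τ 2 = b then (Equiv.Perm.sign τ : ℤ) else 0)) * f a b := by
        simp only [Finset.sum_mul]
        rw [Finset.sum_congr rfl fun a _ => Finset.sum_comm, Finset.sum_comm]
        refine Finset.sum_congr rfl fun τ _ => ?_
        by_cases h0 : τ 0 = 0 <;> simp [h0, ite_and]
    _ = _ := by
        simp only [h]
        simp [Fin.sum_univ_four]
        ring

namespace BoundaryTorus

variable (T : K.BoundaryTorus)

theorem tri_injective (T : K.BoundaryTorus) :
    Function.Injective fun j => (T.tet j, T.lab j 0) := fun i j hij => by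
  have := T.distinct
  fin_cases i <;> fin_cases j <;> first | rfl | exact absurd hij this | exact absurd hij.symm this

/-- The normal coordinates of `S` on the triangle `j` of the torus. -/
def triCount (S : Set K.Space) (j : Fin 2) (a : Fin 4) : ℕ :=
  K.arcCount S (T.tet j) (T.lab j 0) (T.lab j a)

/-- The relabelling of vertices that identifies the edges of the two triangles between the
vertices number `a` and `b`. -/
def edgePerm (a b : Fin 4) : Equiv.Perm (Fin 4) :=
  (T.lab 0).symm.trans ((Equiv.swap a b).trans (T.lab 1))

theorem edgePerm_lab (a b l : Fin 4) : T.edgePerm a b (T.lab 0 l) = T.lab 1 (Equiv.swap a b l) := by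
  simp [edgePerm]

theorem char_edgePerm {a b c : Fin 4} (h : [0, a, b, c].Nodup) {x : Tetra}
    (h0 : x (T.lab 0 0) = 0) (hc : x (T.lab 0 c) = 0) :
    K.char (T.tet 1) (stdSimplex.map (T.edgePerm a b) x) = K.char (T.tet 0) x := by
  obtain ⟨ha, hb, -, hab, -, -⟩ := nodup_ne h
  refine (T.edges a b ha hb hab.symm x fun l hla hlb => ?_).symm
  rcases eq_of_nodup h l with rfl | rfl | rfl | rfl
  · exact h0
  · exact absurd rfl hla
  · exact absurd rfl hlb
  · exact hc

theorem zeros_edgePerm {a b c : Fin 4} (h : [0, a, b, c].Nodup) {x : Tetra} :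
    zeros (stdSimplex.map (T.edgePerm a b) x) = {T.lab 1 0, T.lab 1 c} ↔
      zeros x = {T.lab 0 0, T.lab 0 c} := by
  obtain ⟨ha, hb, hc, hab, hca, hcb⟩ := nodup_ne h
  have : ({T.lab 1 0, T.lab 1 c} : Set (Fin 4)) = T.edgePerm a b '' {T.lab 0 0, T.lab 0 c} := by
    rw [Set.image_pair, edgePerm_lab, edgePerm_lab, Equiv.swap_apply_of_ne_of_ne ha.symm hb.symm,
      Equiv.swap_apply_of_ne_of_ne hca hcb]
  rw [zeros_map, this]
  exact (Set.image_injective.2 (Equiv.injective _)).eq_iff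

/-- The points of `S` on an edge of the torus, seen from its two triangles. -/
theorem edgePts_edgePerm (S : Set K.Space) {a b c : Fin 4} (h : [0, a, b, c].Nodup) :
    edgePts (T.lab 1 0) (T.lab 1 c) (K.trace S (T.tet 1)) =
      stdSimplex.map (T.edgePerm a b) ''
        edgePts (T.lab 0 0) (T.lab 0 c) (K.trace S (T.tet 0)) := by
  have hch : ∀ x : Tetra, zeros x = {T.lab 0 0, T.lab 0 c} →
      K.char (T.tet 1) (stdSimplex.map (T.edgePerm a b) x) = K.char (T.tet 0) x := fun x hx =>
    T.char_edgePerm h (mem_zeros.1 (by simp [hx])) (mem_zeros.1 (by simp [hx]))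
  ext y
  constructor
  · rintro ⟨⟨-, hy⟩, hz⟩
    obtain ⟨x, rfl⟩ : ∃ x, stdSimplex.map (T.edgePerm a b) x = y :=
      ⟨_, map_map_inv (T.edgePerm a b) y⟩
    have hx := (T.zeros_edgePerm h).1 hz
    refine ⟨x, ⟨⟨⟨T.lab 0 0, mem_zeros.1 (by simp [hx])⟩, ?_⟩, hx⟩, rfl⟩
    rwa [hch x hx] at hy
  · rintro ⟨x, ⟨⟨-, hx⟩, hz⟩, rfl⟩
    have hy := (T.zeros_edgePerm h).2 hz
    refine ⟨⟨⟨T.lab 1 0, mem_zeros.1 (by simp [hy])⟩, ?_⟩, hy⟩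
    rwa [hch x hz]

theorem nodup_lab (j : Fin 2) {a b c : Fin 4} (h : [0, a, b, c].Nodup) :
    [T.lab j 0, T.lab j a, T.lab j b, T.lab j c].Nodup :=
  List.Nodup.map (T.lab j).injective h

variable {S : Set K.Space}

theorem ncard_edgePts_tri (hS : K.HasNormalTraces S) (j : Fin 2) {a b c : Fin 4}
    (h : [0, a, b, c].Nodup) :
    (edgePts (T.lab j 0) (T.lab j c) (K.trace S (T.tet j))).ncard =
      T.triCount S j a + T.triCount S j b :=
  (hS.isArcSystem (T.tet j) (T.lab j 0)).ncard_edgePts (T.nodup_lab j h)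

/-- Both sides count the points of `S` on the common edge. The gluing reverses the labels of its
ends, which does not affect the sum. The three edges together determine the three coordinates. -/
theorem triCount_add (hS : K.HasNormalTraces S) {a b c : Fin 4} (h : [0, a, b, c].Nodup) :
    T.triCount S 1 a + T.triCount S 1 b = T.triCount S 0 a + T.triCount S 0 b := by
  rw [← T.ncard_edgePts_tri hS 1 h, ← T.ncard_edgePts_tri hS 0 h, T.edgePts_edgePerm S h,
    Set.ncard_image_of_injective _ (map_perm_injective _)]

/-- The two triangles of the torus have the same normal coordinates. -/
theorem triCount_one (hS : K.HasNormalTraces S) {a : Fin 4} (ha : a ≠ 0) :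
    T.triCount S 1 a = T.triCount S 0 a := by
  obtain ⟨b, c, h⟩ := exists_nodup ha.symm
  have h1 := T.triCount_add hS h
  have h2 := T.triCount_add hS (nodup_swap h)
  have h3 := T.triCount_add hS (nodup_swap (nodup_swap' h))
  omega

/-- The alternating form of the normal coordinates on the torus. -/
def coordForm (F G : Set K.Space) : ℤ :=
  (T.coord F 0 * T.coord G 1 - T.coord F 1 * T.coord G 0)
    + (T.coord F 1 * T.coord G 2 - T.coord F 2 * T.coord G 1)
    + (T.coord F 2 * T.coord G 0 - T.coord F 0 * T.coord G 2)

/-- Relabelling by `lab j` produces its sign, which is the orientation of the tetrahedron and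
squares to 1. -/
theorem orient_mul_facetForm {F G : Set K.Space} (hF : K.HasNormalTraces F)
    (hG : K.HasNormalTraces G) (j : Fin 2) :
    (K.orient (T.tet j) : ℤ) * facetForm F G (T.tet j) (T.lab j 0) = T.coordForm F G := by
  have hc : ∀ S, K.HasNormalTraces S → ∀ i : Fin 3,
      K.arcCount S (T.tet j) (T.lab j 0) (T.lab j i.succ) = T.coord S i := fun S hS i => by
    fin_cases j
    · rfl
    · exact T.triCount_one hS (Fin.succ_ne_zero i)
  have h0 := hc F hF 0
  have h1 := hc F hF 1
  have h2 := hc F hF 2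
  have g0 := hc G hG 0
  have g1 := hc G hG 1
  have g2 := hc G hG 2
  have hs : (K.orient (T.tet j) : ℤ) * K.orient (T.tet j) = 1 := by
    rcases Int.units_eq_one_or (K.orient (T.tet j)) with e | e <;> simp [e]
  rw [facetForm, ← Equiv.sum_comp (Equiv.mulLeft (T.lab j))]
  simp only [Equiv.coe_mulLeft, Equiv.Perm.coe_mul, Function.comp_apply,
    (T.lab j).injective.eq_iff, Equiv.Perm.sign_mul, Units.val_mul, T.positive j]
  have e : ∀ τ : Equiv.Perm (Fin 4), (if τ 0 = 0 then
      ((K.orient (T.tet j) : ℤ) * Equiv.Perm.sign τ) *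
        ((K.arcCount F (T.tet j) (T.lab j 0) (T.lab j (τ 1)) : ℤ) *
          K.arcCount G (T.tet j) (T.lab j 0) (T.lab j (τ 2))) else 0) =
      (K.orient (T.tet j) : ℤ) * (if τ 0 = 0 then (Equiv.Perm.sign τ : ℤ) *
        (fun a b => (K.arcCount F (T.tet j) (T.lab j 0) (T.lab j a) : ℤ) *
          K.arcCount G (T.tet j) (T.lab j 0) (T.lab j b)) (τ 1) (τ 2) else 0) := fun τ => by
    split_ifs <;> simp [mul_assoc]
  simp only [e]
  rw [← Finset.mul_sum, sum_perm_fix_zero fun a b =>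
    (K.arcCount F (T.tet j) (T.lab j 0) (T.lab j a) : ℤ) *
      K.arcCount G (T.tet j) (T.lab j 0) (T.lab j b), ← mul_assoc, hs, one_mul, coordForm]
  simp only [← h0, ← h1, ← h2, ← g0, ← g1, ← g2]
  simp only [show (Fin.succ (0 : Fin 3) : Fin 4) = 1 from rfl,
    show (Fin.succ (1 : Fin 3) : Fin 4) = 2 from rfl,
    show (Fin.succ (2 : Fin 3) : Fin 4) = 3 from rfl]
  ring

end BoundaryTorus

/-- The forms on the two tori of a pair of compatible surfaces are opposite. -/
theorem coordForm_add_coordForm {F G : Set K.Space} (hF : K.HasNormalTraces F)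
    (hG : K.HasNormalTraces G) (hFG : K.Compatible F G) {T₁ T₂ : K.BoundaryTorus}
    (hT : Disjoint T₁.carrier T₂.carrier) (hS : F ∩ K.boundary ⊆ T₁.carrier ∪ T₂.carrier) :
    T₁.coordForm F G + T₂.coordForm F G = 0 := by
  classical
  have := Fintype.ofFinite K.Tet
  have hsum := sum_free_facetForm hF hG hFG
  let q : Fin 2 ⊕ Fin 2 → K.Tet × Fin 4 :=
    Sum.elim (fun j => (T₁.tet j, T₁.lab j 0)) (fun j => (T₂.tet j, T₂.lab j 0))
  have hq : Function.Injective q := by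
    refine Function.Injective.sumElim T₁.tri_injective T₂.tri_injective fun i j hij => ?_
    simp only [Prod.mk.injEq] at hij
    obtain ⟨x, hx⟩ : ∃ x : Tetra, x ∈ facet (T₁.lab i 0) :=
      ⟨stdSimplex.vertex (T₁.lab i 1), by simp [facet]⟩
    refine Set.disjoint_left.1 hT (Set.mem_iUnion.2 ⟨i, x, hx, rfl⟩)
      (Set.mem_iUnion.2 ⟨j, x, ?_, ?_⟩)
    · rwa [← hij.2]
    · rw [hij.1]
  rw [← Finset.sum_subset (Finset.subset_univ (Finset.univ.image q)),
    Finset.sum_image hq.injOn, Fintype.sum_sum_type] at hsum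
  -- Each form appears twice, once for each triangle of its torus.
  · simp only [q, Sum.elim_inl, Sum.elim_inr, T₁.free, T₂.free, if_true,
      T₁.orient_mul_facetForm hF hG, T₂.orient_mul_facetForm hF hG, Fin.sum_univ_two] at hsum
    omega
  -- The form is bilinear, so the absence of arcs of `F` on the remaining free facets is enough.
  · rintro ⟨t, k⟩ - hnot
    split_ifs with hg
    · have hz := arcCount_eq_zero_of_free hS hg
        (fun j e => hnot (Finset.mem_image.2 ⟨.inl j, Finset.mem_univ _, e.symm⟩))
        (fun j e => hnot (Finset.mem_image.2 ⟨.inr j, Finset.mem_univ _, e.symm⟩))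
      simp [facetForm, hz]
    · rfl

end OrientedTriangulation

end NormalSurf

namespace NormalSurf

namespace OrientedTriangulation

variable {K : OrientedTriangulation}

/-! ### Points on the edges of free facets -/

/-- One step of the walk around an edge: a tetrahedron that has been entered through the facet
`k` is left through the other facet at the edge. -/
def EdgeStep (p q : K.Tet × Tetra × Fin 4) : Prop :=
  ∃ c π, zeros p.2.1 = {p.2.2, c} ∧ c ≠ p.2.2 ∧ K.glue p.1 c = some (q.1, π) ∧
    q.2.1 = stdSimplex.map π p.2.1 ∧ q.2.2 = π c

theorem pair_right_unique {k c c' : Fin 4} (hc : c ≠ k)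
    (h : ({k, c} : Set (Fin 4)) = {k, c'}) : c = c' := by
  have : c ∈ ({k, c'} : Set (Fin 4)) := h ▸ (by simp)
  rcases this with rfl | rfl
  · exact absurd rfl hc
  · rfl

/-- Only two facets of a tetrahedron contain a given interior point of an edge, so the exit facet is
determined by the entrance. -/
theorem EdgeStep.rightUnique : Relator.RightUnique (EdgeStep (K := K)) := by
  rintro ⟨t, x, k⟩ ⟨t₁, x₁, k₁⟩ ⟨t₂, x₂, k₂⟩ ⟨c, π, hz, hc, hg, hx, hk⟩ ⟨c', π', hz', hc', hg', hx', hk'⟩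
  simp only at *
  obtain rfl := pair_right_unique hc (hz.symm.trans hz')
  rw [hg] at hg'
  simp only [Option.some.injEq, Prod.mk.injEq] at hg'
  obtain ⟨rfl, rfl⟩ := hg'
  rw [hx, hx', hk, hk']

section Walk

variable {t : K.Tet} {x : Tetra} {k c : Fin 4}

/-- The walk around an edge that starts at a free facet. -/
def EdgeWalk (t : K.Tet) (x : Tetra) (k : Fin 4) : K.Tet × Tetra × Fin 4 → Prop :=
  Relation.ReflTransGen EdgeStep (t, x, k)

theorem EdgeWalk.zeros_eq (hx : zeros x = {k, c}) (hc : c ≠ k) {p : K.Tet × Tetra × Fin 4}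
    (h : EdgeWalk t x k p) : ∃ c', c' ≠ p.2.2 ∧ zeros p.2.1 = {p.2.2, c'} := by
  induction h with
  | refl => exact ⟨c, hc, hx⟩
  | @tail q r hq hqr ih =>
    obtain ⟨c', π, hz, hc', hg, h1, h2⟩ := hqr
    refine ⟨π q.2.2, ?_, ?_⟩
    · rw [h2]; exact fun e => hc' (π.injective e.symm)
    · rw [h1, h2, zeros_map, hz, Set.image_pair, Set.pair_comm]

/-- After the first step, every tetrahedron is entered through a glued facet. -/
theorem EdgeWalk.eq_start {p : K.Tet × Tetra × Fin 4}
    (h : EdgeWalk t x k p) (hp : K.glue p.1 p.2.2 = none) : p = (t, x, k) := by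
  rcases Relation.ReflTransGen.cases_tail h with h | ⟨q, hq, c', π, hz, hc', hg, h1, h2⟩
  · exact h
  · rw [h2, K.glue_symm _ _ _ _ hg] at hp
    cases hp

/-- A gluing along the entrance facet goes one step back, and a gluing along the other facet one
step forward. At the start there is no way back because the facet is free. Hence the walk visits the
whole equivalence class of the point. -/
theorem EdgeWalk.of_glue (hk : K.glue t k = none) (hx : zeros x = {k, c}) (hc : c ≠ k)
    {s s₁ : K.Tet} {l : Fin 4} {π : Equiv.Perm (Fin 4)} {y : Tetra}
    (hg : K.glue s l = some (s₁, π)) (hy : y l = 0) (h : ∃ m, EdgeWalk t x k (s, y, m)) :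
    ∃ m, EdgeWalk t x k (s₁, stdSimplex.map π y, m) := by
  obtain ⟨m, hm⟩ := h
  obtain ⟨c', hc', hz⟩ := hm.zeros_eq hx hc
  simp only at hc' hz
  have hl : l ∈ zeros y := hy
  rw [hz] at hl
  rcases hl with rfl | rfl
  · rcases Relation.ReflTransGen.cases_tail hm with h | ⟨q, hq, c₁, π₁, hz₁, hc₁, hg₁, h1, h2⟩
    · simp only [Prod.mk.injEq] at h
      obtain ⟨rfl, rfl, rfl⟩ := h
      rw [hk] at hg; cases hg
    · simp only at h1 h2 hg₁
      have := K.glue_symm _ _ _ _ hg₁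
      rw [← h2, hg] at this
      simp only [Option.some.injEq, Prod.mk.injEq] at this
      obtain ⟨rfl, rfl⟩ := this
      refine ⟨q.2.2, ?_⟩
      rw [h1, map_inv_map]
      exact hq
  · exact ⟨π l, hm.tail ⟨l, π, hz, hc', hg, rfl, rfl⟩⟩

theorem EdgeWalk.of_char_eq (hk : K.glue t k = none) (hx : zeros x = {k, c}) (hc : c ≠ k)
    {s : K.Tet} {y : Tetra} (h : K.char s y = K.char t x) : ∃ m, EdgeWalk t x k (s, y, m) := by
  let P : K.Space → Prop := Quot.lift (fun q => ∃ m, EdgeWalk t x k (q.1, q.2, m)) (by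
    rintro _ _ ⟨s, l, s₁, π, y, hg, hy⟩
    refine propext ⟨EdgeWalk.of_glue hk hx hc hg hy, fun h => ?_⟩
    have := EdgeWalk.of_glue hk hx hc (K.glue_symm _ _ _ _ hg)
      (by rw [map_apply_perm]; exact hy) h
    rwa [map_inv_map] at this)
  have h1 : P (K.char t x) := ⟨k, .refl⟩
  rw [← h] at h1
  exact h1

/-- A point on an edge of a free facet lies in at most one other free facet. -/
theorem eq_of_char_eq_of_ne (hk : K.glue t k = none) (hx : zeros x = {k, c}) (hc : c ≠ k)
    {t₁ t₂ : K.Tet} {x₁ x₂ : Tetra} {k₁ k₂ : Fin 4} (hk₁ : K.glue t₁ k₁ = none)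
    (hk₂ : K.glue t₂ k₂ = none) (hx₁ : x₁ k₁ = 0) (hx₂ : x₂ k₂ = 0)
    (h₁ : K.char t₁ x₁ = K.char t x) (h₂ : K.char t₂ x₂ = K.char t x)
    (hne₁ : (t₁, x₁, k₁) ≠ (t, x, k)) (hne₂ : (t₂, x₂, k₂) ≠ (t, x, k)) :
    (t₁, x₁, k₁) = (t₂, x₂, k₂) := by
  -- Any other free facet at the point is an exit at which the walk stops, and a deterministic walk
  -- has at most one final state.
  have key : ∀ {t' x' k'}, K.glue t' k' = none → x' k' = 0 → K.char t' x' = K.char t x →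
      (t', x', k') ≠ (t, x, k) → ∃ m, EdgeWalk t x k (t', x', m) ∧ zeros x' = {m, k'} ∧
        k' ≠ m ∧ ∀ q, ¬ EdgeStep (t', x', m) q := by
    intro t' x' k' hk' hx' h' hne
    obtain ⟨m, hm⟩ := EdgeWalk.of_char_eq hk hx hc h'
    obtain ⟨c', hc', hz⟩ := hm.zeros_eq hx hc
    simp only at hc' hz
    have hl : k' ∈ zeros x' := hx'
    rw [hz] at hl
    rcases hl with rfl | rfl
    · exact absurd (hm.eq_start hk') hne
    · refine ⟨m, hm, hz, hc', ?_⟩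
      rintro q ⟨c'', π, hz'', hc'', hg, -⟩
      obtain rfl := pair_right_unique hc' (hz.symm.trans hz'')
      simp only at hg
      rw [hk'] at hg; cases hg
  obtain ⟨m₁, w₁, z₁, n₁, s₁⟩ := key hk₁ hx₁ h₁ hne₁
  obtain ⟨m₂, w₂, z₂, n₂, s₂⟩ := key hk₂ hx₂ h₂ hne₂
  have : (t₁, x₁, m₁) = (t₂, x₂, m₂) := by
    rcases Relation.ReflTransGen.total_of_right_unique EdgeStep.rightUnique w₁ w₂ with h | h
    · rcases Relation.ReflTransGen.cases_head h with h | ⟨q, hq, -⟩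
      · exact h
      · exact absurd hq (s₁ q)
    · rcases Relation.ReflTransGen.cases_head h with h | ⟨q, hq, -⟩
      · exact h.symm
      · exact absurd hq (s₂ q)
  simp only [Prod.mk.injEq] at this
  obtain ⟨rfl, rfl, rfl⟩ := this
  rw [pair_right_unique n₁ (z₁.symm.trans z₂)]

end Walk

end OrientedTriangulation

/-! ### Depths of normal arcs -/

/-- The position of the point `p` among the points of `X` on an edge, counted from the end of
the edge that is not the vertex `u`. -/
def edgeRank (k w u : Fin 4) (X : Set Tetra) (p : Tetra) : ℕ :=
  {q | q ∈ edgePts k w X ∧ q u ≤ p u}.ncard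

/-- The position of a normal arc among the normal arcs of `X` around the same corner, counted
from the corner. -/
def arcDepth (k v : Fin 4) (X A : Set Tetra) : ℕ :=
  {B | B ∈ normalArcs k v X ∧ ∃ u w, [k, v, u, w].Nodup ∧
    arcEnd k w B u ≤ arcEnd k w A u}.ncard

namespace IsArcSystem

variable {k v u w : Fin 4} {X : Set Tetra}

theorem arcEnd_le_iff (hX : IsArcSystem k X) (h : [k, v, u, w].Nodup) {A B : Set Tetra}
    (hA : A ∈ normalArcs k v X) (hB : B ∈ normalArcs k v X) :
    arcEnd k w B u ≤ arcEnd k w A u ↔ arcEnd k u B w ≤ arcEnd k u A w := by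
  obtain ⟨hvk, huk, hwk, huv, hwv, hwu⟩ := nodup_ne h
  by_cases hAB : A = B
  · subst hAB; simp
  have hd := hX.disjoint v v A B hA hB hAB
  have a := hA.1.arcEnd_spec hwk hwv
  have a' := hA.1.arcEnd_spec huk huv
  have b := hB.1.arcEnd_spec hwk hwv
  have b' := hB.1.arcEnd_spec huk huv
  rw [← not_lt, ← not_lt, not_iff_not]
  exact ⟨hB.1.lt_of_disjoint h hA.1 hd.symm b.1 a.1 b'.1 a'.1 b.2 a.2 b'.2 a'.2,
    hB.1.lt_of_disjoint (nodup_swap h) hA.1 hd.symm b'.1 a'.1 b.1 a.1 b'.2 a'.2 b.2 a.2⟩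

/-- The depth of an arc is the position of each of its ends. -/
theorem edgeRank_arcEnd (hX : IsArcSystem k X) (h : [k, v, u, w].Nodup) {A : Set Tetra}
    (hA : A ∈ normalArcs k v X) : edgeRank k w u X (arcEnd k w A) = arcDepth k v X A := by
  obtain ⟨hvk, huk, hwk, huv, hwv, hwu⟩ := nodup_ne h
  have a := hA.1.arcEnd_spec hwk hwv
  have e1 : {B | B ∈ normalArcs k v X ∧ ∃ u w, [k, v, u, w].Nodup ∧
      arcEnd k w B u ≤ arcEnd k w A u} =
      {B | B ∈ normalArcs k v X ∧ arcEnd k w B u ≤ arcEnd k w A u} := by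
    ext B
    refine and_congr_right fun hB => ⟨?_, fun hle => ⟨u, w, h, hle⟩⟩
    rintro ⟨u', w', h', hle⟩
    rcases nodup_eq_or h h' with ⟨rfl, rfl⟩ | ⟨rfl, rfl⟩
    · exact hle
    · exact (hX.arcEnd_le_iff h hA hB).2 hle
  have e2 : {q | q ∈ edgePts k w X ∧ q u ≤ arcEnd k w A u} = arcEnd k w ''
      {B | B ∈ normalArcs k v X ∧ arcEnd k w B u ≤ arcEnd k w A u} := by
    ext q
    constructor
    · rintro ⟨hq, hle⟩
      rw [hX.edgePts_eq h] at hq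
      rcases hq with ⟨B, hB, rfl⟩ | ⟨B, hB, rfl⟩
      · exact ⟨B, ⟨hB, hle⟩, rfl⟩
      · exfalso
        have b := hB.1.arcEnd_spec hwk hwu
        have hAB : A ≠ B := fun e => huv ((e ▸ hA.1).corner_unique hB.1).symm
        have := hA.1.lt_of_disjoint' h hB.1 (hX.disjoint _ _ _ _ hA hB hAB) a.1 b.1 a.2 b.2
        exact absurd hle (not_le.2 this)
    · rintro ⟨B, ⟨hB, hle⟩, rfl⟩
      have b := hB.1.arcEnd_spec hwk hwv
      exact ⟨⟨hB.2 b.1, b.2⟩, hle⟩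
  rw [edgeRank, arcDepth, e1, e2]
  exact ((hX.injOn_arcEnd hwk hwv).mono fun B hB => hB.1).ncard_image

theorem arcDepth_le (hX : IsArcSystem k X) (A : Set Tetra) :
    arcDepth k v X A ≤ (normalArcs k v X).ncard :=
  Set.ncard_le_ncard (fun _ hB => hB.1) (hX.finite v)

/-- Counted from the two ends of the edge, the initial segments up to `p` cover all points and share
only `p`; this gives the summand 1. -/
theorem edgeRank_add (hX : IsArcSystem k X) (h : [k, v, u, w].Nodup) {p : Tetra}
    (hp : p ∈ edgePts k w X) :
    edgeRank k w u X p + edgeRank k w v X p =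
      (normalArcs k v X).ncard + (normalArcs k u X).ncard + 1 := by
  have hfin := hX.finite_edgePts h
  have e1 : {q | q ∈ edgePts k w X ∧ q u ≤ p u} ∪ {q | q ∈ edgePts k w X ∧ q v ≤ p v} =
      edgePts k w X := by
    ext q
    constructor
    · rintro (h | h) <;> exact h.1
    · intro hq
      have h1 := edge_add h hp.2
      have h2 := edge_add h hq.2
      rcases le_total (q u) (p u) with hle | hle
      · exact .inl ⟨hq, hle⟩
      · exact .inr ⟨hq, by linarith⟩
  have e2 : {q | q ∈ edgePts k w X ∧ q u ≤ p u} ∩ {q | q ∈ edgePts k w X ∧ q v ≤ p v} =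
      {p} := by
    ext q
    constructor
    · rintro ⟨⟨hq, h1⟩, -, h2⟩
      have h3 := edge_add h hp.2
      have h4 := edge_add h hq.2
      exact edge_ext h hq.2 hp.2 (by linarith)
    · rintro rfl
      exact ⟨⟨hp, le_rfl⟩, hp, le_rfl⟩
  have := Set.ncard_union_add_ncard_inter {q | q ∈ edgePts k w X ∧ q u ≤ p u}
    {q | q ∈ edgePts k w X ∧ q v ≤ p v} (hfin.subset fun _ hq => hq.1)
    (hfin.subset fun _ hq => hq.1)
  rw [e1, e2, Set.ncard_singleton, hX.ncard_edgePts h] at this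
  exact this.symm

end IsArcSystem

/-! ### Functions that are constant on normal arcs -/

/-- The function on the normal arcs of `X` in the facet `k` whose value at an arc is given by the
corner and the depth of the arc. -/
def arcVal (k : Fin 4) (X : Set Tetra) (c : Fin 4 → ℕ → ℝ) (p : Tetra) : ℝ :=
  Classical.epsilon fun r => ∃ v A, A ∈ normalArcs k v X ∧ p ∈ A ∧ r = c v (arcDepth k v X A)

namespace IsArcSystem

variable {k v u w : Fin 4} {X : Set Tetra} {c : Fin 4 → ℕ → ℝ}

theorem arcVal_eq (hX : IsArcSystem k X) {A : Set Tetra} (hA : A ∈ normalArcs k v X) {p : Tetra}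
    (hp : p ∈ A) : arcVal k X c p = c v (arcDepth k v X A) := by
  obtain ⟨v', B, hB, hpB, h⟩ := Classical.epsilon_spec
    (p := fun r => ∃ v A, A ∈ normalArcs k v X ∧ p ∈ A ∧ r = c v (arcDepth k v X A))
    ⟨_, v, A, hA, hp, rfl⟩
  rw [arcVal, h]
  obtain rfl := hX.eq_of_mem hA hB hp hpB
  obtain rfl := hA.1.corner_unique hB.1
  rfl

theorem isCompact_inter (hX : IsArcSystem k X) : IsCompact (X ∩ facet k) := by
  rw [hX.sUnion]
  refine (Set.finite_iUnion hX.finite).isCompact_sUnion fun A hA => ?_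
  obtain ⟨v, hA⟩ := Set.mem_iUnion.1 hA
  exact hA.1.isCompact

/-- The function is constant on each of finitely many closed arcs that cover the domain. -/
theorem continuousOn_arcVal (hX : IsArcSystem k X) :
    ContinuousOn (arcVal k X c) (X ∩ facet k) := by
  have hfin : Finite (⋃ v, normalArcs k v X) := Set.finite_iUnion hX.finite
  rw [hX.sUnion, Set.sUnion_eq_iUnion]
  refine (locallyFinite_of_finite _).continuousOn_iUnion (fun A => ?_) fun A => ?_
  · obtain ⟨v, hA⟩ := Set.mem_iUnion.1 A.2
    exact hA.1.isCompact.isClosed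
  · obtain ⟨v, hA⟩ := Set.mem_iUnion.1 A.2
    exact continuousOn_const.congr fun p hp => hX.arcVal_eq hA hp

/-- The value at an end of an arc in terms of the position of the end on the edge. -/
theorem arcVal_edgePts (hX : IsArcSystem k X) (h : [k, v, u, w].Nodup) {p : Tetra}
    (hp : p ∈ edgePts k w X) :
    arcVal k X c p = if edgeRank k w u X p ≤ (normalArcs k v X).ncard then
        c v (edgeRank k w u X p)
      else c u ((normalArcs k v X).ncard + (normalArcs k u X).ncard + 1 - edgeRank k w u X p) := by
  obtain ⟨hvk, huk, hwk, huv, hwv, hwu⟩ := nodup_ne h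
  have hadd := hX.edgeRank_add h hp
  have hp' := hp
  rw [hX.edgePts_eq h] at hp'
  rcases hp' with ⟨A, hA, rfl⟩ | ⟨A, hA, rfl⟩
  · rw [hX.arcVal_eq hA (hA.1.arcEnd_spec hwk hwv).1, hX.edgeRank_arcEnd h hA,
      if_pos (hX.arcDepth_le A)]
  · rw [hX.arcVal_eq hA (hA.1.arcEnd_spec hwk hwu).1]
    rw [hX.edgeRank_arcEnd (nodup_swap' h) hA] at hadd
    have := hX.arcDepth_le (v := u) A
    rw [if_neg (by omega)]
    congr 1
    omega

theorem edgeRank_pos (hX : IsArcSystem k X) (h : [k, v, u, w].Nodup) {p : Tetra}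
    (hp : p ∈ edgePts k w X) : 1 ≤ edgeRank k w u X p ∧
      edgeRank k w u X p ≤ (normalArcs k v X).ncard + (normalArcs k u X).ncard := by
  have hfin := hX.finite_edgePts h
  constructor
  · rw [Nat.one_le_iff_ne_zero]
    exact Set.ncard_ne_zero_of_mem ⟨hp, le_rfl⟩ (hfin.subset fun _ hq => hq.1)
  · rw [← hX.ncard_edgePts h]
    exact Set.ncard_le_ncard (fun _ hq => hq.1) hfin

end IsArcSystem

end NormalSurf

namespace NormalSurf

/-! ### Lifts to the universal cover of the circle -/

theorem exists_int_of_coe_eq {r s : ℝ} (h : (r : UnitAddCircle) = (s : UnitAddCircle)) :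
    ∃ n : ℤ, r - s = n := by
  have : ((r - s : ℝ) : UnitAddCircle) = 0 := by rw [AddCircle.coe_sub, h, sub_self]
  obtain ⟨n, hn⟩ := (AddCircle.coe_eq_zero_iff (1 : ℝ)).1 this
  exact ⟨n, by rw [← hn]; simp⟩

/-- Two different values would force a whole interval of values. This is how lattice-valued
differences are shown to be constant. -/
theorem eq_of_countable_image {α : Type*} [TopologicalSpace α] {s : Set α} (hs : IsPreconnected s)
    {f : α → ℝ} (hf : ContinuousOn f s) (hc : (f '' s).Countable) {x y : α} (hx : x ∈ s)
    (hy : y ∈ s) : f x = f y := by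
  by_contra hne
  wlog hlt : f x < f y generalizing x y
  · exact this hy hx (Ne.symm hne) (lt_of_le_of_ne (not_lt.1 hlt) (Ne.symm hne))
  obtain ⟨z, hz, hz'⟩ := (hc.dense_compl ℝ).exists_between hlt
  exact hz ((hs.image f hf).Icc_subset ⟨x, hx, rfl⟩ ⟨y, hy, rfl⟩ ⟨hz'.1.le, hz'.2.le⟩)

instance : ContractibleSpace Tetra :=
  (convex_stdSimplex ℝ (Fin 4)).contractibleSpace ⟨_, single_mem_stdSimplex ℝ 0⟩

/-- Read backwards, the contraction of the simplex is a homotopy from a constant to `f`; it is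
lifted from a constant lift, and its end is taken. -/
theorem exists_lift_circle (f : C(Tetra, UnitAddCircle)) :
    ∃ φ : C(Tetra, ℝ), ∀ x, ((φ x : ℝ) : UnitAddCircle) = f x := by
  obtain ⟨y, ⟨H⟩⟩ := id_nullhomotopic Tetra
  obtain ⟨r, hr⟩ : ∃ r : ℝ, (r : UnitAddCircle) = f y := QuotientAddGroup.mk_surjective _
  let G : C(unitInterval × Tetra, UnitAddCircle) := f.comp H.symm.toContinuousMap
  have hcov : IsCoveringMap ((↑) : ℝ → UnitAddCircle) := AddCircle.isCoveringMap_coe 1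
  have h0 : ∀ a, G (0, a) = ((ContinuousMap.const Tetra r a : ℝ) : UnitAddCircle) := fun a => by
    simp [G, hr]
  refine ⟨(hcov.liftHomotopy G (ContinuousMap.const Tetra r) h0).comp
    ((ContinuousMap.const Tetra 1).prodMk (ContinuousMap.id Tetra)), fun x => ?_⟩
  have := congrFun (hcov.liftHomotopy_lifts G (ContinuousMap.const Tetra r) h0) (1, x)
  refine this.trans ?_
  simp [G]

theorem isPreconnected_edge (k w : Fin 4) : IsPreconnected {x : Tetra | x k = 0 ∧ x w = 0} := by
  rw [← Topology.IsInducing.subtypeVal.isPreconnected_image]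
  apply Convex.isPreconnected
  have : Subtype.val '' {x : Tetra | x k = 0 ∧ x w = 0} =
      stdSimplex ℝ (Fin 4) ∩ {f | f k = 0} ∩ {f | f w = 0} := by
    ext f
    constructor
    · rintro ⟨x, ⟨h1, h2⟩, rfl⟩
      exact ⟨⟨x.2, h1⟩, h2⟩
    · rintro ⟨⟨hf, h1⟩, h2⟩
      exact ⟨⟨f, hf⟩, ⟨h1, h2⟩, rfl⟩
  rw [this]
  have hc : ∀ i, Convex ℝ {f : Fin 4 → ℝ | f i = 0} := fun i =>
    (convex_singleton (0 : ℝ)).linear_preimage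
      (LinearMap.proj (R := ℝ) (φ := fun _ : Fin 4 => ℝ) i)
  exact ((convex_stdSimplex ℝ (Fin 4)).inter (hc k)).inter (hc w)

namespace OrientedTriangulation

variable {K : OrientedTriangulation}

theorem continuous_char (t : K.Tet) : Continuous (K.char t) :=
  continuous_quot_mk.comp (continuous_sigmaMk (σ := fun _ : K.Tet => Tetra))

namespace BoundaryTorus

variable (T : K.BoundaryTorus)

theorem char_mem_carrier (j : Fin 2) {x : Tetra} (hx : x ∈ facet (T.lab j 0)) :
    K.char (T.tet j) x ∈ T.carrier := Set.mem_iUnion.2 ⟨j, x, hx, rfl⟩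

variable {T} in
/-- `φ` lifts the triangle `j` of the torus to the universal cover. -/
def IsLift (h : T.HomologyBasis) (j : Fin 2) (φ : Tetra → ℝ × ℝ) : Prop :=
  ContinuousOn φ (facet (T.lab j 0)) ∧
    ∀ x ∈ facet (T.lab j 0), ∀ y : T.carrier, y.1 = K.char (T.tet j) x →
      h y = (((φ x).1 : UnitAddCircle), ((φ x).2 : UnitAddCircle))

variable {T}

theorem exists_isLift (h : T.HomologyBasis) (j : Fin 2) : ∃ φ, IsLift h j φ := by
  -- This vertex map induces a retraction of the simplex onto the facet, so the lift can be
  -- constructed on the whole simplex.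
  let e : Fin 4 → Fin 4 := fun i => if i = T.lab j 0 then T.lab j 1 else i
  have hne : T.lab j 1 ≠ T.lab j 0 := fun e => by simpa using (T.lab j).injective e
  have he : ∀ x : Tetra, stdSimplex.map e x ∈ facet (T.lab j 0) := fun x => by
    simp only [facet, Set.mem_ofPred_eq, stdSimplex.map_coe, FunOnFinite.linearMap_apply_apply]
    refine Finset.sum_eq_zero fun i hi => ?_
    have := (Finset.mem_filter.1 hi).2
    simp only [e] at this
    split_ifs at this with h1
    · exact absurd this hne
    · exact absurd this h1
  have hid : ∀ x ∈ facet (T.lab j 0), stdSimplex.map e x = x := fun x hx => by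
    ext i
    rw [stdSimplex.map_coe, FunOnFinite.linearMap_apply_apply]
    by_cases hi : i = T.lab j 0
    · subst hi
      have := he x
      simp only [facet, Set.mem_ofPred_eq, stdSimplex.map_coe,
        FunOnFinite.linearMap_apply_apply] at this
      exact this.trans (Eq.symm hx)
    · by_cases hi1 : i = T.lab j 1
      · subst hi1
        rw [Finset.sum_eq_single (T.lab j 1)]
        · intro l hl hl1
          have := (Finset.mem_filter.1 hl).2
          simp only [e] at this
          split_ifs at this with h1
          · rw [h1]; exact hx
          · exact absurd this hl1
        · intro hl
          exact absurd (Finset.mem_filter.2 ⟨Finset.mem_univ _, by simp [e]⟩) hl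
      · rw [Finset.sum_eq_single i]
        · intro l hl hl1
          have := (Finset.mem_filter.1 hl).2
          simp only [e] at this
          split_ifs at this with h1
          · exact absurd this.symm hi1
          · exact absurd this hl1
        · intro hl
          exact absurd (Finset.mem_filter.2 ⟨Finset.mem_univ _, by simp [e, hi]⟩) hl
  let f : C(Tetra, UnitAddCircle × UnitAddCircle) :=
    ⟨fun x => h ⟨K.char (T.tet j) (stdSimplex.map e x), T.char_mem_carrier j (he x)⟩,
      h.continuous.comp (((continuous_char _).comp (stdSimplex.continuous_map e)).subtype_mk _)⟩
  obtain ⟨φ₁, h₁⟩ := exists_lift_circle (ContinuousMap.fst.comp f)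
  obtain ⟨φ₂, h₂⟩ := exists_lift_circle (ContinuousMap.snd.comp f)
  refine ⟨fun x => (φ₁ x, φ₂ x), (φ₁.continuous.prodMk φ₂.continuous).continuousOn,
    fun x hx y hy => ?_⟩
  simp only [h₁, h₂]
  have : y = ⟨K.char (T.tet j) (stdSimplex.map e x), T.char_mem_carrier j (he x)⟩ :=
    Subtype.ext (hy.trans (congrArg (K.char _) (hid x hx).symm))
  rw [this]
  rfl

variable {h : T.HomologyBasis} {φ : Fin 2 → Tetra → ℝ × ℝ}

theorem IsLift.exists_int {j j' : Fin 2} {φ φ' : Tetra → ℝ × ℝ} (hφ : IsLift h j φ)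
    (hφ' : IsLift h j' φ') {x x' : Tetra} (hx : x ∈ facet (T.lab j 0))
    (hx' : x' ∈ facet (T.lab j' 0)) (hxx : K.char (T.tet j) x = K.char (T.tet j') x') :
    ∃ m n : ℤ, φ x - φ' x' = ((m : ℝ), (n : ℝ)) := by
  have h1 := hφ.2 x hx ⟨_, T.char_mem_carrier j hx⟩ rfl
  have h2 := hφ'.2 x' hx' ⟨_, T.char_mem_carrier j hx⟩ hxx
  rw [h1, Prod.mk.injEq] at h2
  obtain ⟨m, hm⟩ := exists_int_of_coe_eq h2.1
  obtain ⟨n, hn⟩ := exists_int_of_coe_eq h2.2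
  exact ⟨m, n, Prod.ext hm hn⟩

theorem edgePerm_mem_facet {a b c : Fin 4} (hn : [0, a, b, c].Nodup) {x : Tetra}
    (hx : x ∈ facet (T.lab 0 0)) : stdSimplex.map (T.edgePerm a b) x ∈ facet (T.lab 1 0) := by
  obtain ⟨ha, hb, -⟩ := nodup_ne hn
  have : T.lab 1 0 = T.edgePerm a b (T.lab 0 0) := by
    rw [edgePerm_lab, Equiv.swap_apply_of_ne_of_ne ha.symm hb.symm]
  show _ = _
  rw [this, map_apply_perm]
  exact hx

/-- The lifts of the two triangles differ by a constant on each edge. -/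
theorem lift_sub_lift (hφ : ∀ j, IsLift h j (φ j)) {a b c : Fin 4} (hn : [0, a, b, c].Nodup)
    {x : Tetra} (h0 : x (T.lab 0 0) = 0) (hc : x (T.lab 0 c) = 0) :
    φ 0 x - φ 1 (stdSimplex.map (T.edgePerm a b) x) =
      φ 0 (stdSimplex.vertex (T.lab 0 a)) - φ 1 (stdSimplex.vertex (T.lab 1 b)) := by
  obtain ⟨ha, hb, hc0, hab, hca, hcb⟩ := nodup_ne hn
  set E := {x : Tetra | x (T.lab 0 0) = 0 ∧ x (T.lab 0 c) = 0} with hE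
  set f : Tetra → ℝ × ℝ := fun x => φ 0 x - φ 1 (stdSimplex.map (T.edgePerm a b) x) with hf
  have hfc : ContinuousOn f E := by
    refine ((hφ 0).1.mono fun x hx => hx.1).sub ((hφ 1).1.comp
      (stdSimplex.continuous_map _).continuousOn fun x hx => edgePerm_mem_facet hn hx.1)
  have hfi : ∀ x ∈ E, ∃ m n : ℤ, f x = ((m : ℝ), (n : ℝ)) := fun x hx =>
    (hφ 0).exists_int (hφ 1) hx.1 (edgePerm_mem_facet hn hx.1)
      (T.char_edgePerm hn hx.1 hx.2).symm
  have hvE : stdSimplex.vertex (T.lab 0 a) ∈ E := by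
    simp [hE, ha, hca]
  have hvv : stdSimplex.map (T.edgePerm a b) (stdSimplex.vertex (T.lab 0 a) : Tetra) =
      stdSimplex.vertex (T.lab 1 b) := by
    rw [stdSimplex.map_vertex, edgePerm_lab, Equiv.swap_apply_left]
  have key : f x = f (stdSimplex.vertex (T.lab 0 a)) := by
    refine Prod.ext ?_ ?_
    · refine eq_of_countable_image (f := fun x => (f x).1) (isPreconnected_edge _ _)
        (continuous_fst.comp_continuousOn hfc) ?_ ⟨h0, hc⟩ hvE
      refine (Set.countable_range fun m : ℤ => (m : ℝ)).mono ?_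
      rintro _ ⟨y, hy, rfl⟩
      obtain ⟨m, n, hmn⟩ := hfi y hy
      exact ⟨m, (congrArg Prod.fst hmn).symm⟩
    · refine eq_of_countable_image (f := fun x => (f x).2) (isPreconnected_edge _ _)
        (continuous_snd.comp_continuousOn hfc) ?_ ⟨h0, hc⟩ hvE
      refine (Set.countable_range fun m : ℤ => (m : ℝ)).mono ?_
      rintro _ ⟨y, hy, rfl⟩
      obtain ⟨m, n, hmn⟩ := hfi y hy
      exact ⟨n, (congrArg Prod.snd hmn).symm⟩
  rw [hf] at key
  simpa only [hvv] using key

/-! ### Potentials on a normal curve in the torus -/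

variable {S : Set K.Space}

/-- The function on the triangle `j` which is given by a linear function on the universal cover
and a correction that depends only on the corners and the depths of the arcs. -/
def triPotential (S : Set K.Space) (φ : Fin 2 → Tetra → ℝ × ℝ) (ℓ : ℝ × ℝ →ₗ[ℝ] ℝ)
    (C : Fin 2 → Fin 4 → ℕ → ℝ) (j : Fin 2) (x : Tetra) : ℝ :=
  ℓ (φ j x) + arcVal (T.lab j 0) (K.trace S (T.tet j)) (fun v => C j ((T.lab j).symm v)) x

/-- The corrections are compatible with the gluing of the edge between `a` and `b`. -/
def IsEdgePotential (T : K.BoundaryTorus) (S : Set K.Space) (φ : Fin 2 → Tetra → ℝ × ℝ)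
    (ℓ : ℝ × ℝ →ₗ[ℝ] ℝ) (C : Fin 2 → Fin 4 → ℕ → ℝ) (a b : Fin 4) : Prop :=
  -- `r` is the position of a point of the edge, counted from corner `a` of triangle 0, which is
  -- glued to corner `b` of triangle 1. The corrections on its two sides must differ by the constant
  -- difference of the lifts.
  ∀ r, 1 ≤ r → r ≤ T.triCount S 0 a + T.triCount S 0 b →
    (if r ≤ T.triCount S 0 b then C 1 b r
      else C 1 a (T.triCount S 0 b + T.triCount S 0 a + 1 - r)) -
    (if r ≤ T.triCount S 0 a then C 0 a r
      else C 0 b (T.triCount S 0 a + T.triCount S 0 b + 1 - r)) =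
    ℓ (φ 0 (stdSimplex.vertex (T.lab 0 a)) - φ 1 (stdSimplex.vertex (T.lab 1 b)))

/-- The corrections are compatible with the gluing of all edges. -/
def IsPotential (T : K.BoundaryTorus) (S : Set K.Space) (φ : Fin 2 → Tetra → ℝ × ℝ)
    (ℓ : ℝ × ℝ →ₗ[ℝ] ℝ) (C : Fin 2 → Fin 4 → ℕ → ℝ) : Prop :=
  ∀ a b c, [0, a, b, c].Nodup → IsEdgePotential T S φ ℓ C a b

variable {ℓ : ℝ × ℝ →ₗ[ℝ] ℝ} {C : Fin 2 → Fin 4 → ℕ → ℝ}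

theorem edgeRank_edgePerm {a b c : Fin 4} (hn : [0, a, b, c].Nodup) (p : Tetra) :
    edgeRank (T.lab 1 0) (T.lab 1 c) (T.lab 1 a) (K.trace S (T.tet 1))
        (stdSimplex.map (T.edgePerm a b) p) =
      edgeRank (T.lab 0 0) (T.lab 0 c) (T.lab 0 b) (K.trace S (T.tet 0)) p := by
  have hab : T.lab 1 a = T.edgePerm a b (T.lab 0 b) := by
    rw [edgePerm_lab, Equiv.swap_apply_right]
  refine Eq.trans ?_ (Set.ncard_image_of_injective _ (map_perm_injective (T.edgePerm a b)))
  rw [edgeRank]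
  congr 1
  rw [T.edgePts_edgePerm S hn, hab]
  ext q
  constructor
  · rintro ⟨⟨x, hx, rfl⟩, hle⟩
    rw [map_apply_perm, map_apply_perm] at hle
    exact ⟨x, ⟨hx, hle⟩, rfl⟩
  · rintro ⟨x, ⟨hx, hle⟩, rfl⟩
    refine ⟨⟨x, hx, rfl⟩, ?_⟩
    rwa [map_apply_perm, map_apply_perm]

theorem triPotential_edgePerm (hS : K.HasNormalTraces S) (hφ : ∀ j, IsLift h j (φ j))
    (hC : IsPotential T S φ ℓ C) {a b c : Fin 4} (hn : [0, a, b, c].Nodup) {p : Tetra}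
    (hp : p ∈ edgePts (T.lab 0 0) (T.lab 0 c) (K.trace S (T.tet 0))) :
    triPotential (T := T) S φ ℓ C 0 p =
      triPotential (T := T) S φ ℓ C 1 (stdSimplex.map (T.edgePerm a b) p) := by
  have hX0 := hS.isArcSystem (T.tet 0) (T.lab 0 0)
  have hX1 := hS.isArcSystem (T.tet 1) (T.lab 1 0)
  have hp' : stdSimplex.map (T.edgePerm a b) p ∈
      edgePts (T.lab 1 0) (T.lab 1 c) (K.trace S (T.tet 1)) := by
    rw [T.edgePts_edgePerm S hn]; exact ⟨p, hp, rfl⟩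
  have hr := hX0.edgeRank_pos (T.nodup_lab 0 hn) hp
  obtain ⟨ha, hb, -⟩ := nodup_ne hn
  have key := hC a b c hn _ hr.1 hr.2
  rw [← lift_sub_lift hφ hn (x := p) (mem_zeros.1 (by simp [hp.2])) (mem_zeros.1 (by simp [hp.2])),
    map_sub] at key
  have e0 : ∀ a, (normalArcs (T.lab 0 0) (T.lab 0 a) (K.trace S (T.tet 0))).ncard =
    T.triCount S 0 a := fun a => rfl
  have e1 : ∀ a, a ≠ 0 → (normalArcs (T.lab 1 0) (T.lab 1 a) (K.trace S (T.tet 1))).ncard =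
    T.triCount S 0 a := fun a ha => T.triCount_one hS ha
  rw [triPotential, triPotential, hX0.arcVal_edgePts (T.nodup_lab 0 hn) hp,
    hX1.arcVal_edgePts (T.nodup_lab 1 (nodup_swap' hn)) hp', edgeRank_edgePerm hn]
  simp only [Equiv.symm_apply_apply, e0, e1 a ha, e1 b hb]
  linarith

/-- An interior point of the triangle is identified with no other point. A point on an edge lies in
only one other free facet, namely triangle 1 through `edgePerm`. -/
theorem triPotential_eq_zero (hS : K.HasNormalTraces S) (hφ : ∀ j, IsLift h j (φ j))
    (hC : IsPotential T S φ ℓ C) {j' : Fin 2} {x x' : Tetra}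
    (hx : x ∈ K.trace S (T.tet 0) ∩ facet (T.lab 0 0))
    (hx' : x' ∈ K.trace S (T.tet j') ∩ facet (T.lab j' 0))
    (hxx : K.char (T.tet j') x' = K.char (T.tet 0) x) :
    triPotential (T := T) S φ ℓ C j' x' = triPotential (T := T) S φ ℓ C 0 x := by
  obtain ⟨v, A, hA, hxA⟩ := (hS.isArcSystem (T.tet 0) (T.lab 0 0)).cover x hx.1 hx.2
  rcases hA.1.zeros_eq hxA with hz | ⟨c, hc, -, hz⟩
  · obtain ⟨e1, e2⟩ := Sigma.mk.inj_iff.1 (eq_of_char_eq (T.free 0) hz hxx)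
    obtain rfl := eq_of_heq e2
    have : T.lab j' 0 ∈ zeros x' := hx'.2
    rw [hz] at this
    obtain rfl := T.tri_injective (a₁ := j') (a₂ := 0) (Prod.ext e1 this)
    rfl
  · obtain ⟨c, rfl⟩ := (T.lab 0).surjective c
    have hc0 : c ≠ 0 := fun e => hc (by rw [e])
    obtain ⟨a, b, hn'⟩ := exists_nodup hc0.symm
    have hn : [0, a, b, c].Nodup := nodup_swap (nodup_swap' hn')
    have hp : x ∈ edgePts (T.lab 0 0) (T.lab 0 c) (K.trace S (T.tet 0)) := ⟨hx.1, hz⟩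
    by_cases he : (T.tet j', x', T.lab j' 0) = (T.tet 0, x, T.lab 0 0)
    · simp only [Prod.mk.injEq] at he
      obtain ⟨e1, rfl, e3⟩ := he
      obtain rfl := T.tri_injective (a₁ := j') (a₂ := 0) (Prod.ext e1 e3)
      rfl
    · have hne : (T.tet 1, stdSimplex.map (T.edgePerm a b) x, T.lab 1 0) ≠
          (T.tet 0, x, T.lab 0 0) := fun e => by
        simp only [Prod.mk.injEq] at e
        exact T.distinct (Prod.ext e.1.symm e.2.2.symm)
      have := eq_of_char_eq_of_ne (T.free 0) hz hc (T.free j') (T.free 1) hx'.2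
        (edgePerm_mem_facet hn hx.2) hxx
        (T.char_edgePerm hn hx.2 (mem_zeros.1 (by simp [hz]))) he hne
      simp only [Prod.mk.injEq] at this
      obtain ⟨e1, rfl, e3⟩ := this
      obtain rfl := T.tri_injective (a₁ := j') (a₂ := 1) (Prod.ext e1 e3)
      exact (triPotential_edgePerm hS hφ hC hn hp).symm

/-- The potentials on the two triangles define a function on `S ∩ T`. -/
theorem triPotential_eq (hS : K.HasNormalTraces S) (hφ : ∀ j, IsLift h j (φ j))
    (hC : IsPotential T S φ ℓ C) {j j' : Fin 2} {x x' : Tetra}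
    (hx : x ∈ K.trace S (T.tet j) ∩ facet (T.lab j 0))
    (hx' : x' ∈ K.trace S (T.tet j') ∩ facet (T.lab j' 0))
    (hxx : K.char (T.tet j') x' = K.char (T.tet j) x) :
    triPotential (T := T) S φ ℓ C j' x' = triPotential (T := T) S φ ℓ C j x := by
  obtain rfl | rfl : j = 0 ∨ j = 1 := by fin_cases j <;> simp
  · exact triPotential_eq_zero hS hφ hC hx hx' hxx
  obtain rfl | rfl : j' = 0 ∨ j' = 1 := by fin_cases j' <;> simp
  · exact (triPotential_eq_zero hS hφ hC hx' hx hxx.symm).symm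
  -- Both points lie in triangle 1. On an edge they are compared through their counterpart in
  -- triangle 0.
  obtain ⟨v, A, hA, hxA⟩ := (hS.isArcSystem (T.tet 1) (T.lab 1 0)).cover x hx.1 hx.2
  rcases hA.1.zeros_eq hxA with hz | ⟨c, hc, -, hz⟩
  · obtain ⟨-, e2⟩ := Sigma.mk.inj_iff.1 (eq_of_char_eq (T.free 1) hz hxx)
    rw [eq_of_heq e2]
  · obtain ⟨c, rfl⟩ := (T.lab 1).surjective c
    have hc0 : c ≠ 0 := fun e => hc (by rw [e])
    obtain ⟨a, b, hn'⟩ := exists_nodup hc0.symm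
    have hn : [0, a, b, c].Nodup := nodup_swap (nodup_swap' hn')
    have hp : x ∈ edgePts (T.lab 1 0) (T.lab 1 c) (K.trace S (T.tet 1)) := ⟨hx.1, hz⟩
    rw [T.edgePts_edgePerm S hn] at hp
    obtain ⟨y, hy, rfl⟩ := hp
    have hy0 : y (T.lab 0 0) = 0 := mem_zeros.1 (by simp [hy.2])
    have e := T.char_edgePerm hn hy0 (mem_zeros.1 (by simp [hy.2]))
    rw [triPotential_eq_zero hS hφ hC ⟨hy.1, hy0⟩ hx e,
      triPotential_eq_zero hS hφ hC ⟨hy.1, hy0⟩ hx' (hxx.trans e)]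

/-- A linear function that admits a potential on `S ∩ T` vanishes on the classes of the closed
curves in `S ∩ T`. -/
theorem apply_class_eq_zero (hS : K.HasNormalTraces S) (hφ : ∀ j, IsLift h j (φ j))
    (hC : IsPotential T S φ ℓ C) {γ : UnitAddCircle → T.carrier} (hγ : Continuous γ)
    (hγS : ∀ s, (γ s).1 ∈ S) {a b : ℤ} (hab : T.HasClass h γ a b) :
    ℓ ((a : ℝ), (b : ℝ)) = 0 := by
  have hX := fun j => hS.isArcSystem (T.tet j) (T.lab j 0)
  have hℓ : Continuous ℓ := ℓ.continuous_of_finiteDimensional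
  let D : Type := Σ j : Fin 2, ↥(K.trace S (T.tet j) ∩ facet (T.lab j 0))
  have hcomp : ∀ j, CompactSpace ↥(K.trace S (T.tet j) ∩ facet (T.lab j 0)) := fun j =>
    isCompact_iff_compactSpace.1 (hX j).isCompact_inter
  have : CompactSpace D := inferInstanceAs (CompactSpace (Σ j : Fin 2, _))
  have : T2Space T.carrier := h.isEmbedding.t2Space
  let Y : Type := {y : T.carrier // y.1 ∈ S}
  let q : D → Y := fun p =>
    ⟨⟨K.char (T.tet p.1) p.2.1, T.char_mem_carrier p.1 p.2.2.2⟩, p.2.2.1.2⟩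
  have hq : Continuous q := by
    refine continuous_sigma fun j => ?_
    have hc : Continuous fun x : ↥(K.trace S (T.tet j) ∩ facet (T.lab j 0)) =>
        K.char (T.tet j) x.1 := (continuous_char _).comp continuous_subtype_val
    exact (hc.subtype_mk fun x => T.char_mem_carrier j x.2.2).subtype_mk fun x => x.2.1.2
  have hqs : Function.Surjective q := by
    rintro ⟨⟨y, hy⟩, hyS⟩
    obtain ⟨j, x, hx, rfl⟩ := Set.mem_iUnion.1 hy
    exact ⟨⟨j, x, ⟨⟨_, hx⟩, hyS⟩, hx⟩, rfl⟩
  -- `S ∩ T` is a quotient of the compact disjoint union of its traces in the two triangles, so the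
  -- potentials descend to a continuous function.
  have hquot : Topology.IsQuotientMap q := hq.isClosedMap.isQuotientMap hq hqs
  let G : D → ℝ := fun p => triPotential (T := T) S φ ℓ C p.1 p.2.1
  have hG : Continuous G := by
    refine continuous_sigma fun j => ?_
    have : ContinuousOn (triPotential (T := T) S φ ℓ C j)
        (K.trace S (T.tet j) ∩ facet (T.lab j 0)) :=
      (hℓ.comp_continuousOn ((hφ j).1.mono Set.inter_subset_right)).add
        (hX j).continuousOn_arcVal
    exact this.domRestrict
  have hGq : ∀ p p', q p = q p' → G p = G p' := fun p p' hpp =>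
    triPotential_eq hS hφ hC p'.2.2 p.2.2 (congrArg (fun y : Y => y.1.1) hpp)
  let F : Y → ℝ := fun y => G (Function.surjInv hqs y)
  have hFq : ∀ p, F (q p) = G p := fun p => hGq _ _ (Function.surjInv_eq hqs _)
  have hF : Continuous F := by
    rw [hquot.continuous_iff]
    convert hG using 1
    exact funext hFq
  obtain ⟨g, hg, hgγ, hper⟩ := hab
  let δ : ℝ → Y := fun s => ⟨γ (s : UnitAddCircle), hγS _⟩
  have hδ : Continuous δ := (hγ.comp (AddCircle.continuous_mk' 1)).subtype_mk _
  have hθ : Continuous fun s => ℓ (g s) - F (δ s) := (hℓ.comp hg).sub (hF.comp hδ)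
  -- On each arc the two functions differ by the value of `ℓ` at a lattice vector and a correction,
  -- so their difference takes countably many values and is constant. Comparing the parameters 0 and
  -- 1 then leaves `ℓ` of the class.
  have hcount : ((fun s => ℓ (g s) - F (δ s)) '' Set.univ).Countable := by
    refine (Set.countable_range fun z : (ℤ × ℤ) × Fin 2 × Fin 4 × ℕ =>
      ℓ ((z.1.1 : ℝ), (z.1.2 : ℝ)) - C z.2.1 ((T.lab z.2.1).symm z.2.2.1) z.2.2.2).mono ?_
    rintro _ ⟨s, -, rfl⟩
    obtain ⟨⟨j, x, hx⟩, hp⟩ := hqs (δ s)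
    obtain ⟨v, A, hA, hxA⟩ := (hX j).cover x hx.1 hx.2
    have h1 := hgγ s
    rw [(hφ j).2 x hx.2 _ (congrArg (fun y : Y => y.1.1) hp).symm, Prod.mk.injEq] at h1
    obtain ⟨m, hm⟩ := exists_int_of_coe_eq h1.1.symm
    obtain ⟨n, hn⟩ := exists_int_of_coe_eq h1.2.symm
    refine ⟨((m, n), j, v, arcDepth (T.lab j 0) v (K.trace S (T.tet j)) A), ?_⟩
    have e1 : ((m : ℝ), (n : ℝ)) = g s - φ j x := Prod.ext hm.symm hn.symm
    simp only
    rw [← hp, hFq, e1, map_sub]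
    simp only [G, triPotential, (hX j).arcVal_eq hA hxA]
    ring
  have hconst := eq_of_countable_image isPreconnected_univ hθ.continuousOn hcount
    (Set.mem_univ (0 + 1 : ℝ)) (Set.mem_univ 0)
  have hδ1 : δ (0 + 1) = δ 0 := by
    have : (((0 + 1 : ℝ)) : UnitAddCircle) = ((0 : ℝ) : UnitAddCircle) := by
      rw [AddCircle.coe_add]; simp [AddCircle.coe_period]
    exact Subtype.ext (congrArg γ this)
  rw [hδ1, hper, map_add] at hconst
  linarith

end BoundaryTorus

end OrientedTriangulation

end NormalSurf

/-! ### Slopes computed from normal coordinates -/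

namespace NormalSurf

open SlopeAlgebra

namespace OrientedTriangulation

variable {K : OrientedTriangulation}

namespace BoundaryTorus

variable {T : K.BoundaryTorus} {h : T.HomologyBasis} {φ : Fin 2 → Tetra → ℝ × ℝ} {S : Set K.Space}
  {ℓ : ℝ × ℝ →ₗ[ℝ] ℝ}

theorem vertex_mem_facet {j : Fin 2} {a : Fin 4} (ha : a ≠ 0) :
    (stdSimplex.vertex (T.lab j a) : Tetra) ∈ facet (T.lab j 0) := by
  have : T.lab j 0 ≠ T.lab j a := fun e => ha ((T.lab j).injective e).symm
  simp [facet, this]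

theorem lift_sub_lift_comm (hφ : ∀ j, IsLift h j (φ j)) {a b c : Fin 4} (hn : [0, a, b, c].Nodup) :
    φ 0 (stdSimplex.vertex (T.lab 0 a)) - φ 1 (stdSimplex.vertex (T.lab 1 b)) =
      φ 0 (stdSimplex.vertex (T.lab 0 b)) - φ 1 (stdSimplex.vertex (T.lab 1 a)) := by
  obtain ⟨ha, hb, hc, hab, hca, hcb⟩ := nodup_ne hn
  rw [← lift_sub_lift hφ hn (x := stdSimplex.vertex (T.lab 0 b)) (vertex_mem_facet hb)
    (by simp [hcb]), stdSimplex.map_vertex, edgePerm_lab, Equiv.swap_apply_right]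

/-- All corners of a triangle of the torus are the same vertex. -/
theorem char_vertex (T : K.BoundaryTorus) {a b c : Fin 4} (hn : [0, a, b, c].Nodup) :
    K.char (T.tet 0) (stdSimplex.vertex (T.lab 0 a)) =
      K.char (T.tet 0) (stdSimplex.vertex (T.lab 0 b)) := by
  obtain ⟨ha, hb, hc, hab, hca, hcb⟩ := nodup_ne hn
  have h1 := T.char_edgePerm (nodup_swap hn) (x := stdSimplex.vertex (T.lab 0 a))
    (vertex_mem_facet ha) (by simp [hab])
  have h2 := T.char_edgePerm (nodup_swap (nodup_swap' hn)) (x := stdSimplex.vertex (T.lab 0 b))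
    (vertex_mem_facet hb) (by simp [hab.symm])
  rw [stdSimplex.map_vertex, edgePerm_lab, Equiv.swap_apply_left] at h1 h2
  exact h1.symm.trans h2

/-- The positions are read from the other end of the edge, so `r` becomes the number of points plus
1 minus `r`. -/
theorem IsEdgePotential.symm (hφ : ∀ j, IsLift h j (φ j)) {C : Fin 2 → Fin 4 → ℕ → ℝ}
    {a b c : Fin 4} (hn : [0, a, b, c].Nodup) (hC : IsEdgePotential T S φ ℓ C a b) :
    IsEdgePotential T S φ ℓ C b a := by
  intro r hr1 hr2
  have key := hC (T.triCount S 0 a + T.triCount S 0 b + 1 - r) (by omega) (by omega)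
  rw [lift_sub_lift_comm hφ hn] at key
  rw [← key]
  generalize T.triCount S 0 a = x at *
  generalize T.triCount S 0 b = y at *
  congr 1
  · by_cases hr : r ≤ x
    · rw [if_pos hr, if_neg (by omega), show y + x + 1 - (x + y + 1 - r) = r by omega]
    · rw [if_neg hr, if_pos (by omega)]
  · by_cases hr : r ≤ y
    · rw [if_pos hr, if_neg (by omega), show x + y + 1 - (x + y + 1 - r) = r by omega]
    · rw [if_neg hr, if_pos (by omega), Nat.add_comm y x]

theorem isPotential_of_symm (hφ : ∀ j, IsLift h j (φ j)) {C : Fin 2 → Fin 4 → ℕ → ℝ}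
    {a b i : Fin 4} (hn : [0, a, b, i].Nodup) (hab : IsEdgePotential T S φ ℓ C a b)
    (hai : IsEdgePotential T S φ ℓ C a i) (hbi : IsEdgePotential T S φ ℓ C b i) :
    IsPotential T S φ ℓ C := by
  intro a' b' c' hn'
  obtain ⟨ha', hb', -, hab', -⟩ := nodup_ne hn'
  rcases (eq_of_nodup hn a').resolve_left ha' with rfl | rfl | rfl <;>
    rcases (eq_of_nodup hn b').resolve_left hb' with rfl | rfl | rfl <;>
    first
    | exact absurd rfl hab'
    | assumption
    | exact IsEdgePotential.symm hφ hn ‹_›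
    | exact IsEdgePotential.symm hφ (nodup_swap hn) ‹_›
    | exact IsEdgePotential.symm hφ (nodup_swap (nodup_swap' hn)) ‹_›

/-- The corrections that turn a linear function into a potential: the arcs in the vertex links
are corrected by a constant, and the other arcs, which all have an end on the edge between `a`
and `b`, by a multiple of the position of this end. -/
def correction (T : K.BoundaryTorus) (S : Set K.Space) (φ : Fin 2 → Tetra → ℝ × ℝ)
    (ℓ : ℝ × ℝ →ₗ[ℝ] ℝ) (lam : ℝ) (a b i : Fin 4) (j : Fin 2) (v : Fin 4) (r : ℕ) : ℝ :=
  if r ≤ T.triCount S 0 i then -ℓ (φ j (stdSimplex.vertex (T.lab j v))) else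
    (if (j = 0 ↔ v = a) then lam * r
      else lam * (T.triCount S 0 a + T.triCount S 0 b + 1 - r)) +
    (if j = 0 then 0 else ℓ (φ 0 (stdSimplex.vertex (T.lab 0 a))) -
      ℓ (φ 1 (stdSimplex.vertex (T.lab 1 b))))

/-- Vertex link arcs match because their potential measures `ℓ` from the vertex. The other arcs
match on the edge `a b` by construction. Across the edges `a i` and `b i` their position changes by
`x b - x i` and `-(x a - x i)`, and `hℓ` makes `ℓ` compensate this. If all coordinates are equal
there are only vertex links, and no condition on `ℓ` is needed. -/
theorem isPotential_correction (hφ : ∀ j, IsLift h j (φ j)) {lam : ℝ} {a b i : Fin 4}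
    (hn : [0, a, b, i].Nodup) (hia : T.triCount S 0 i ≤ T.triCount S 0 a)
    (hib : T.triCount S 0 i ≤ T.triCount S 0 b)
    (hℓ : T.triCount S 0 i < T.triCount S 0 a ∨ T.triCount S 0 i < T.triCount S 0 b →
      ℓ (φ 0 (stdSimplex.vertex (T.lab 0 i))) - ℓ (φ 0 (stdSimplex.vertex (T.lab 0 b))) =
          lam * (T.triCount S 0 b - T.triCount S 0 i) ∧
        ℓ (φ 0 (stdSimplex.vertex (T.lab 0 i))) - ℓ (φ 0 (stdSimplex.vertex (T.lab 0 a))) =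
          -(lam * (T.triCount S 0 a - T.triCount S 0 i))) :
    IsPotential T S φ ℓ (correction T S φ ℓ lam a b i) := by
  obtain ⟨ha, hb, hi, hab, hia', hib'⟩ := nodup_ne hn
  have g1 := congrArg ℓ (lift_sub_lift_comm hφ hn)
  have g2 := congrArg ℓ (lift_sub_lift_comm hφ (nodup_swap hn))
  have g3 := congrArg ℓ (lift_sub_lift_comm hφ (nodup_swap (nodup_swap' hn)))
  simp only [map_sub] at g1 g2 g3
  generalize hxa : T.triCount S 0 a = xa at *
  generalize hxb : T.triCount S 0 b = xb at *
  generalize hxi : T.triCount S 0 i = xi at *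
  generalize hA0 : ℓ (φ 0 (stdSimplex.vertex (T.lab 0 a))) = A0 at *
  generalize hB0 : ℓ (φ 0 (stdSimplex.vertex (T.lab 0 b))) = B0 at *
  generalize hI0 : ℓ (φ 0 (stdSimplex.vertex (T.lab 0 i))) = I0 at *
  generalize hA1 : ℓ (φ 1 (stdSimplex.vertex (T.lab 1 a))) = A1 at *
  generalize hB1 : ℓ (φ 1 (stdSimplex.vertex (T.lab 1 b))) = B1 at *
  generalize hI1 : ℓ (φ 1 (stdSimplex.vertex (T.lab 1 i))) = I1 at *
  have e10 : ((1 : Fin 2) = 0) = False := by simp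
  have c0a : ∀ r : ℕ, correction T S φ ℓ lam a b i 0 a r = if r ≤ xi then -A0 else lam * r :=
    fun r => by simp only [correction, hxi, hA0, if_true, add_zero]
  have c0b : ∀ r : ℕ, correction T S φ ℓ lam a b i 0 b r =
      if r ≤ xi then -B0 else lam * (xa + xb + 1 - r) := fun r => by
    simp only [correction, hxi, hxa, hxb, hB0, hab, if_true, if_false, add_zero, true_iff]
  have c1a : ∀ r : ℕ, correction T S φ ℓ lam a b i 1 a r =
      if r ≤ xi then -A1 else lam * (xa + xb + 1 - r) + (A0 - B1) := fun r => by
    simp only [correction, hxi, hxa, hxb, hA0, hA1, hB1, e10, if_false, false_iff,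
      not_true_eq_false]
  have c1b : ∀ r : ℕ, correction T S φ ℓ lam a b i 1 b r =
      if r ≤ xi then -B1 else lam * r + (A0 - B1) := fun r => by
    simp only [correction, hxi, hA0, hB1, e10, hab, if_true, if_false]
  have ci : ∀ j r, r ≤ xi → correction T S φ ℓ lam a b i j i r =
      -ℓ (φ j (stdSimplex.vertex (T.lab j i))) := fun j r hr => by
    simp only [correction, hxi, hr, if_true]
  have c0i : ∀ r, r ≤ xi → correction T S φ ℓ lam a b i 0 i r = -I0 := fun r hr => by
    rw [ci 0 r hr, hI0]
  have c1i : ∀ r, r ≤ xi → correction T S φ ℓ lam a b i 1 i r = -I1 := fun r hr => by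
    rw [ci 1 r hr, hI1]
  have hcast : ∀ x y r : ℕ, r ≤ x + y → ((x + y + 1 - r : ℕ) : ℝ) = x + y + 1 - r :=
    fun x y r hr => by rw [Nat.cast_sub (by omega)]; push_cast; ring
  refine isPotential_of_symm hφ hn ?_ ?_ ?_
  · intro r hr1 hr2
    rw [map_sub, hxa, hxb] at *
    rw [hA0, hB1, c1b, c1a, c0a, c0b, hcast _ _ _ hr2, hcast _ _ _ (by omega)]
    clear hℓ ci c0i c1i c0a c0b c1a c1b g2 g3 hφ
    split_ifs <;> first | (exfalso; omega) | linarith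
  · intro r hr1 hr2
    rw [map_sub, hxa, hxi] at *
    rw [hA0, hI1, c1a, c0a, hcast _ _ _ (by omega)]
    by_cases h1 : r ≤ xi
    · rw [if_pos h1, if_pos (h1.trans hia), if_pos h1, c1i r h1]
      ring
    by_cases h2 : r ≤ xa
    · have := (hℓ (.inl (by omega))).1
      rw [if_neg h1, if_neg (by omega), if_pos h2, if_neg h1]
      linarith
    · rw [if_neg h1, if_pos (by omega), if_neg h2, c0i _ (by omega)]
      linarith
  · intro r hr1 hr2
    rw [map_sub, hxb, hxi] at *
    rw [hB0, hI1, c1b, c0b, hcast _ _ _ (by omega)]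
    by_cases h1 : r ≤ xi
    · rw [if_pos h1, if_pos (h1.trans hib), if_pos h1, c1i r h1]
      ring
    by_cases h2 : r ≤ xb
    · have := (hℓ (.inr (by omega))).2
      rw [if_neg h1, if_neg (by omega), if_pos h2, if_neg h1]
      linarith
    · rw [if_neg h1, if_pos (by omega), if_neg h2, c0i _ (by omega)]
      linarith

/-- The determinant with a fixed vector as a linear function. -/
def detLin (v : ℝ × ℝ) : ℝ × ℝ →ₗ[ℝ] ℝ :=
  v.1 • LinearMap.snd ℝ ℝ ℝ - v.2 • LinearMap.fst ℝ ℝ ℝ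

theorem detLin_apply (v z : ℝ × ℝ) : detLin v z = v.1 * z.2 - v.2 * z.1 := by
  simp [detLin]

/-- The slope of a normal curve in terms of its normal coordinates. -/
theorem class_eq_zero_of_coords (hS : K.HasNormalTraces S) (hφ : ∀ j, IsLift h j (φ j))
    {a b i : Fin 4} (hn : [0, a, b, i].Nodup) (hia : T.triCount S 0 i ≤ T.triCount S 0 a)
    (hib : T.triCount S 0 i ≤ T.triCount S 0 b) {u w : ℝ × ℝ}
    (hu : φ 0 (stdSimplex.vertex (T.lab 0 a)) - φ 0 (stdSimplex.vertex (T.lab 0 i)) = u)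
    (hw : φ 0 (stdSimplex.vertex (T.lab 0 b)) - φ 0 (stdSimplex.vertex (T.lab 0 i)) = w)
    {γ : UnitAddCircle → T.carrier} (hγ : Continuous γ)
    (hγS : ∀ s, (γ s).1 ∈ S) {k l : ℤ} (hkl : T.HasClass h γ k l) (p q : ℝ)
    (hp : p = T.triCount S 0 a - T.triCount S 0 i) (hq : q = T.triCount S 0 b - T.triCount S 0 i) :
    (detLin (q • u + p • w) ((k : ℝ), (l : ℝ)) = 0) ∧
      (p = 0 → q = 0 → ((k : ℝ), (l : ℝ)) = (0, 0)) := by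
  have key : ∀ (ℓ : ℝ × ℝ →ₗ[ℝ] ℝ) (lam : ℝ),
      (p ≠ 0 ∨ q ≠ 0 → ℓ w = -(lam * q) ∧ ℓ u = lam * p) →
      ℓ ((k : ℝ), (l : ℝ)) = 0 := fun ℓ lam hℓ => by
    refine apply_class_eq_zero hS hφ (isPotential_correction hφ hn hia hib (lam := lam)
      fun hlt => ?_) hγ hγS hkl
    obtain ⟨h1, h2⟩ := hℓ (by
      rcases hlt with hlt | hlt
      · left; rw [hp]; exact (sub_pos.2 (by exact_mod_cast hlt)).ne'
      · right; rw [hq]; exact (sub_pos.2 (by exact_mod_cast hlt)).ne')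
    rw [← hw, map_sub] at h1
    rw [← hu, map_sub] at h2
    rw [← hp, ← hq]
    constructor <;> linarith
  -- With `v = q u + p w` one has `det(v, w) = q det(u, w)` and `det(v, u) = -p det(u, w)`, so the
  -- factor must be `-det(u, w)`.
  refine ⟨key _ (u.2 * w.1 - u.1 * w.2) fun _ => ?_, fun hp0 hq0 => ?_⟩
  · simp only [detLin_apply, Prod.fst_add, Prod.snd_add, Prod.smul_fst, Prod.smul_snd, smul_eq_mul]
    constructor <;> ring
  · have h1 := key (LinearMap.fst ℝ ℝ ℝ) 0 (fun h => by simp [hp0, hq0] at h)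
    have h2 := key (LinearMap.snd ℝ ℝ ℝ) 0 (fun h => by simp [hp0, hq0] at h)
    exact Prod.ext h1 h2

/-- The vector in `ℚ²` that is computed from the normal coordinates of a surface of type `i`. -/
def slopeVec (T : K.BoundaryTorus) (i : Fin 3) (u w : ℤ × ℤ) (S : Set K.Space) : ℚ × ℚ :=
  (((T.coord S (i + 2) : ℚ) - T.coord S i) * u.1 + ((T.coord S (i + 1) : ℚ) - T.coord S i) * w.1,
    ((T.coord S (i + 2) : ℚ) - T.coord S i) * u.2 + ((T.coord S (i + 1) : ℚ) - T.coord S i) * w.2)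

/-- The form is the determinant against `(1, 1, 1)`, so subtracting coordinate `i` throughout does
not change it. The sign arises because `u` is paired with coordinate `i + 2` and `w` with `i + 1`.
-/
theorem det2_slopeVec (T : K.BoundaryTorus) (i : Fin 3) (u w : ℤ × ℤ) (F G : Set K.Space) :
    det2 (slopeVec T i u w F) (slopeVec T i u w G) = -(det2 u w : ℤ) * T.coordForm F G := by
  fin_cases i <;> simp [det2, slopeVec, coordForm] <;> ring

theorem nodup_cyc (i : Fin 3) : [0, (i + 1).succ, (i + 2).succ, i.succ].Nodup := by
  revert i; decide

/-- The slope of the surfaces of type `i` on a torus is a function of their normal coordinates. -/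
theorem exists_slopeVec (h : T.HomologyBasis) {d : ℤ} (hd : d ≠ 0) (hh : T.BasisSign h d)
    (i : Fin 3) : ∃ u w : ℤ × ℤ, det2 u w = d ∧ ∀ S, K.HasNormalTraces S → T.HasType S i →
      ∀ r, T.IsSlope h S r → slopeVec T i u w S ≠ 0 ∧ r = slopeQ (slopeVec T i u w S) := by
  obtain ⟨φ₀, hφc, hφl, hdet⟩ := hh
  obtain ⟨φ₁, hφ₁⟩ := exists_isLift h 1
  let φ : Fin 2 → Tetra → ℝ × ℝ := ![φ₀, φ₁]
  have hφ₀ : IsLift h 0 φ₀ := ⟨hφc, hφl⟩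
  have hφ : ∀ j, IsLift h j (φ j) := fun j => by
    fin_cases j
    · exact hφ₀
    · exact hφ₁
  have hn := nodup_cyc i
  obtain ⟨ha, hb, hi, -⟩ := nodup_ne hn
  have hint : ∀ {a b c : Fin 4}, [0, a, b, c].Nodup → ∃ m n : ℤ,
      φ₀ (stdSimplex.vertex (T.lab 0 a)) - φ₀ (stdSimplex.vertex (T.lab 0 b)) =
        ((m : ℝ), (n : ℝ)) := fun {a b c} hn =>
    hφ₀.exists_int hφ₀ (vertex_mem_facet (nodup_ne hn).1) (vertex_mem_facet (nodup_ne hn).2.1)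
      (T.char_vertex hn)
  obtain ⟨u₁, u₂, hu⟩ := hint (nodup_swap hn)
  obtain ⟨w₁, w₂, hw⟩ := hint (nodup_swap (nodup_swap' hn))
  -- The determinant of two sides of the triangle is the same from each corner, in cyclic order.
  have hdet' : (u₁ : ℝ) * w₂ - u₂ * w₁ = d := by
    have e1 := congrArg Prod.fst hu
    have e2 := congrArg Prod.snd hu
    have e3 := congrArg Prod.fst hw
    have e4 := congrArg Prod.snd hw
    simp only [Prod.fst_sub, Prod.snd_sub] at e1 e2 e3 e4
    rw [← e1, ← e2, ← e3, ← e4, ← hdet]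
    fin_cases i
    · show (((φ₀ (stdSimplex.vertex (T.lab 0 2))).1 - (φ₀ (stdSimplex.vertex (T.lab 0 1))).1) *
        ((φ₀ (stdSimplex.vertex (T.lab 0 3))).2 - (φ₀ (stdSimplex.vertex (T.lab 0 1))).2) -
        ((φ₀ (stdSimplex.vertex (T.lab 0 2))).2 - (φ₀ (stdSimplex.vertex (T.lab 0 1))).2) *
        ((φ₀ (stdSimplex.vertex (T.lab 0 3))).1 - (φ₀ (stdSimplex.vertex (T.lab 0 1))).1)) = _
      ring
    · show (((φ₀ (stdSimplex.vertex (T.lab 0 3))).1 - (φ₀ (stdSimplex.vertex (T.lab 0 2))).1) *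
        ((φ₀ (stdSimplex.vertex (T.lab 0 1))).2 - (φ₀ (stdSimplex.vertex (T.lab 0 2))).2) -
        ((φ₀ (stdSimplex.vertex (T.lab 0 3))).2 - (φ₀ (stdSimplex.vertex (T.lab 0 2))).2) *
        ((φ₀ (stdSimplex.vertex (T.lab 0 1))).1 - (φ₀ (stdSimplex.vertex (T.lab 0 2))).1)) = _
      ring
    · show (((φ₀ (stdSimplex.vertex (T.lab 0 1))).1 - (φ₀ (stdSimplex.vertex (T.lab 0 3))).1) *
        ((φ₀ (stdSimplex.vertex (T.lab 0 2))).2 - (φ₀ (stdSimplex.vertex (T.lab 0 3))).2) -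
        ((φ₀ (stdSimplex.vertex (T.lab 0 1))).2 - (φ₀ (stdSimplex.vertex (T.lab 0 3))).2) *
        ((φ₀ (stdSimplex.vertex (T.lab 0 2))).1 - (φ₀ (stdSimplex.vertex (T.lab 0 3))).1)) = _
      ring
  have hdetZ : u₁ * w₂ - u₂ * w₁ = d := by exact_mod_cast hdet'
  refine ⟨(u₁, u₂), (w₁, w₂), hdetZ, fun S hS hty r hr => ?_⟩
  obtain ⟨γ, hγ, -, ⟨pt, -, hcomp⟩, k, l, hkl, hclass, rfl⟩ := hr
  have hγS : ∀ s, (γ s).1 ∈ S := fun s => by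
    have : (γ s).1 ∈ connectedComponentIn (S ∩ T.carrier) pt := hcomp ▸ ⟨γ s, ⟨s, rfl⟩, rfl⟩
    exact (connectedComponentIn_subset _ _ this).1
  set p : ℤ := (T.coord S (i + 1) : ℤ) - T.coord S i with hp
  set q : ℤ := (T.coord S (i + 2) : ℤ) - T.coord S i with hq
  obtain ⟨hpar, hzero⟩ := class_eq_zero_of_coords hS hφ hn (hty (i + 1)) (hty (i + 2)) hu hw hγ
    hγS hclass p q (by rw [hp]; push_cast; rfl) (by rw [hq]; push_cast; rfl)
  have hvec : slopeVec T i (u₁, u₂) (w₁, w₂) S =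
      (((q * u₁ + p * w₁ : ℤ) : ℚ), ((q * u₂ + p * w₂ : ℤ) : ℚ)) := by
    rw [hp, hq]; push_cast; rfl
  have hparZ : (q * u₁ + p * w₁) * l - (q * u₂ + p * w₂) * k = 0 := by
    simp only [detLin_apply, Prod.fst_add, Prod.snd_add, Prod.smul_fst, Prod.smul_snd,
      smul_eq_mul] at hpar
    exact_mod_cast hpar
  -- `u` and `w` are independent, so a zero vector forces `p = q = 0`, and then the class of the
  -- curve would be zero.
  have hv0 : slopeVec T i (u₁, u₂) (w₁, w₂) S ≠ 0 := by
    rw [hvec]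
    intro h0
    simp only [Prod.mk_eq_zero, Int.cast_eq_zero] at h0
    have hp0 : p * d = 0 := by
      rw [← hdetZ]; linear_combination (-u₂) * h0.1 + u₁ * h0.2
    have hq0 : q * d = 0 := by
      rw [← hdetZ]; linear_combination w₂ * h0.1 - w₁ * h0.2
    have hp0 : p = 0 := by simpa [hd] using hp0
    have hq0 : q = 0 := by simpa [hd] using hq0
    have := hzero (by simp [hp0]) (by simp [hq0])
    simp only [Prod.mk.injEq, Int.cast_eq_zero] at this
    exact hkl (Prod.ext this.1 this.2)
  refine ⟨hv0, ?_⟩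
  have hslope : slopeOf k l = slopeQ ((k : ℚ), (l : ℚ)) := by
    simp [slopeOf, slopeQ]
  rw [hslope]
  refine slopeQ_eq_of_det_eq_zero (fun h0 => ?_) hv0 ?_
  · simp only [Prod.mk_eq_zero, Int.cast_eq_zero] at h0
    exact hkl (Prod.ext h0.1 h0.2)
  · rw [hvec]
    simp only [det2]
    have : k * (q * u₂ + p * w₂) - l * (q * u₁ + p * w₁) = 0 := by linarith
    exact_mod_cast this

end BoundaryTorus

end OrientedTriangulation

end NormalSurf

end

theorem lemma2p3 (K : NormalSurf.OrientedTriangulation) (hK : K.IsManifold)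
    (T₁ T₂ : K.BoundaryTorus) (hT : Disjoint T₁.carrier T₂.carrier)
    (h₁ : T₁.HomologyBasis) (hh₁ : T₁.BasisAgrees h₁)
    (h₂ : T₂.HomologyBasis) (hh₂ : T₂.BasisDisagrees h₂)
    (C : Set (Set K.Space)) (hC : K.IsCompatibilityClass C) (i j : Fin 3) :
    ∃ Φ : SL(2, ℚ), ∀ S ∈ NormalSurf.OrientedTriangulation.typedClass T₁ T₂ C i j,
      S ∩ K.boundary ⊆ T₁.carrier ∪ T₂.carrier →
      ∀ r₁ r₂ : OnePoint ℚ, T₁.IsSlope h₁ S r₁ → T₂.IsSlope h₂ S r₂ →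
        (Φ : GL (Fin 2) ℚ) • r₂ = r₁ := by
  open NormalSurf OrientedTriangulation BoundaryTorus SlopeAlgebra in
  obtain ⟨u₁, w₁, hd₁, H₁⟩ := exists_slopeVec h₁ (d := 1) (by decide)
    (by simpa [BasisAgrees] using hh₁) i
  obtain ⟨u₂, w₂, hd₂, H₂⟩ := exists_slopeVec h₂ (d := -1) (by decide)
    (by simpa [BasisDisagrees] using hh₂) j
  have hnormal : ∀ S ∈ C, K.HasNormalTraces S := fun S hS => (hC.1.1 S hS).2
  let P : Set K.Space → Prop := fun S => S ∈ typedClass T₁ T₂ C i j ∧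
    S ∩ K.boundary ⊆ T₁.carrier ∪ T₂.carrier ∧ (∃ r, T₁.IsSlope h₁ S r) ∧ ∃ r, T₂.IsSlope h₂ S r
  obtain ⟨Φ, hΦ⟩ := exists_SL2_slopeQ P (slopeVec T₁ i u₁ w₁) (slopeVec T₂ j u₂ w₂)
    (fun S hS => by
      obtain ⟨⟨hSC, ht, -⟩, -, ⟨r, hr⟩, -⟩ := hS
      exact (H₁ S (hnormal S hSC) ht r hr).1)
    (fun S hS => by
      obtain ⟨⟨hSC, -, ht⟩, -, -, ⟨r, hr⟩⟩ := hS
      exact (H₂ S (hnormal S hSC) ht r hr).1)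
    (fun F G hF hG => by
      -- The signs 1 and -1 of the bases cancel the opposite signs of the two forms. Compatibility
      -- is available only for distinct surfaces; for `F = G` both forms vanish by antisymmetry.
      rw [det2_slopeVec, det2_slopeVec, hd₁, hd₂]
      by_cases hFG : F = G
      · subst hFG
        simp only [coordForm]
        push_cast
        ring
      · have := coordForm_add_coordForm (hnormal F hF.1.1) (hnormal G hG.1.1)
          (hC.1.2 hF.1.1 hG.1.1 hFG) hT hF.2.1
        have h2 : T₂.coordForm F G = -T₁.coordForm F G := by linarith
        rw [h2]
        push_cast
        ring)
  refine ⟨Φ, fun S hS hb r₁ r₂ hr₁ hr₂ => ?_⟩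
  rw [(H₁ S (hnormal S hS.1) hS.2.1 r₁ hr₁).2, (H₂ S (hnormal S hS.1) hS.2.2 r₂ hr₂).2]
  exact hΦ S ⟨hS, hb, ⟨r₁, hr₁⟩, r₂, hr₂⟩
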